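/- **Theorem (the implicit Euler scheme for the heat equation on Sierpiński simplices).** Let $d\ge 1$ and let $P_0,\dots,P_{d-1}\in\mathbb R^{d-1}$ be affinely independent. Put $f_i(X)=\frac12(X+P_{i-1})$ for $1\le i\le d$, $V_0=\{P_0,\dots,P_{d-1}\}$, $V_{m}=\bigcup_i f_i(V_{m-1})$ for $m\ge1$, and let $\mathfrak{SS}=\overline{\bigcup_m V_m}$ be the Sierpiński simplex, the unique nonempty compact set with $\mathfrak{SS}=\bigcup_i f_i(\mathfrak{SS})$; its boundary is $V_0$. Write $X\sim_m Y$ if $X=f_{w_1}\circ\dots\circ f_{w_m}(P_i)$ and $Y=f_{w_1}\circ\dots\circ f_{w_m}(P_j)$ for a word $w\in\{1,\dots,d\}^m$ and some $i\ne j$, and for $X\in V_m\setminus V_0$ set $$\Delta_m v(X)=\sum_{Y\sim_m X}(v(Y)-v(X)),\qquad c_m=\tfrac d2(d+2)^m .$$ A continuous function $v$ on $\mathfrak{SS}$ is in the domain of the Laplacian, with Laplacian the continuous function $\Delta v$ on $\mathfrak{SS}$, if $c_m\Delta_m v(X_m)\to\Delta v(X)$ for all $X\in\mathfrak{SS}$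 and all sequences $X_m\in V_m\setminus V_0$ ($m\ge1$) with $X_m\to X$. Let $\tilde\Delta_m$ be the matrix indexed by $V_m\setminus V_0$ with diagonal entries $c_m\,\#\{Z\in V_m: Z\sim_m X\}$, entries $-c_m$ at pairs $X\sim_m Y$, and all other entries $0$; let $\tilde A=I+h\tilde\Delta_m$. For $h>0$, $m\ge 0$, $N\ge 0$ and a function $g$, the implicit Euler scheme is: for $0\le k<N$ and $X\in V_m\setminus V_0$, $$\frac{u_h^m((k+1)h,X)-u_h^m(kh,X)}h=c_m\,\Delta_m u_h^m((k+1)h,\cdot)(X),$$ with $u_h^m(kh,P_j)=0$ for $0\le k\le N$, and $u^m_h(0,X)=g(X)$ for $X\in V_m\setminus V_0$. Let $U(k)$ be the vector $(u_h^m(kh,X))_{X\in V_m\setminus V_0}$. 1. For all $m\ge0$ and $h>0$, $\tilde A$ is invertible, $\|\tilde A^{-1}\|_\infty\le1$ and $\|\tilde A^{-n}\|_\infty\le 1$ for all $n\ge0$, in the operator norm induced by the sup norm. 2. For all $m\ge 0$, $h>0$, $N\ge 0$ and $g$, the scheme has exactly one solution on $V_m$ for $0\le k\le N$; it satisfies $\tilde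 A\,U(k)=U(k-1)$ for $1\le k\le N$, and the scheme is unconditionally stable in the sup norm: $\|U(k)\|_\infty\le\|U(0)\|_\infty$ for $0\le k\le N$. 3. Let $T>0$, $\alpha\ge0$, and let $u:[0,T]\times\mathfrak{SS}\to\mathbb R$ solve the heat equation: for every $t\in\,]0,T[$, $u(t,\cdot)$ is in the domain of the Laplacian and $\partial_tu(t,X)=\Delta u(t,X)$ for all $X\in\mathfrak{SS}$; $u(t,X)=0$ for $X\in V_0$ and $t\in[0,T[$; and $u(0,\cdot)=g$ on $\mathfrak{SS}$. Suppose that for every $X\in\mathfrak{SS}$ the function $u(\cdot,X)$ is twice differentiable on $[0,T]$, with $|\partial_t^2u|$ bounded on $[0,T]\times\mathfrak{SS}$, and that for every $t\in\,]0,T[$ there is $C(t)$ with $|u(t,X)-u(t,Y)|\le C(t)|X-Y|^\alpha$ for all $X,Y\in\mathfrak{SS}$. For $N\ge1$ and $h=T/N$, let $u_h^m$ be the solution of the scheme, and let $$\|w\|_{2,\infty}=\max_{0\le k\le N}\Big(d^{-m}\sum_{X\in V_m}|w(kh,X)|^2\Big)^{1/2}.$$ Then there is a constant $C$, independent of $m$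 and $N$, such that for all $m\ge0$ and $N\ge1$ $$\|u-u_h^m\|_{2,\infty}\le C\,(h+2^{-m\alpha}),$$ and $\|u-u_h^m\|_{2,\infty}\to0$ as $m\to\infty$ and $N\to\infty$ independently, with no restriction linking $h$ and $m$. -/

import Mathlib

open Filter Topology Set

noncomputable section

namespace SierpinskiHeat

/-- The Euclidean space of dimension `d - 1`. -/
abbrev Space (d : ℕ) : Type := EuclideanSpace ℝ (Fin (d - 1))

/-- The contraction `X ↦ (X + P i) / 2` of ratio `1/2`, with fixed point `P i`. -/
def contraction {d : ℕ} (P : Fin d → Space d) (i : Fin d) (X : Space d) : Space d :=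
  (2⁻¹ : ℝ) • (X + P i)

/-- The composition of the contractions along a word. -/
def wordMap {d : ℕ} (P : Fin d → Space d) : List (Fin d) → Space d → Space d
  | [] => id
  | i :: w => contraction P i ∘ wordMap P w

open scoped Classical in
/-- The vertex sets: `V 0 = {P 0, …, P (d - 1)}` and `V (m + 1)` is the union of the images of
`V m` under the contractions. -/
def vertices {d : ℕ} (P : Fin d → Space d) : ℕ → Finset (Space d)
  | 0 => Finset.univ.image P
  | m + 1 => Finset.univ.biUnion fun i => (vertices P m).image (contraction P i)

open scoped Classical in
/-- The interior vertices `V m \ V 0`. -/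
def interiorVertices {d : ℕ} (P : Fin d → Space d) (m : ℕ) : Finset (Space d) :=
  vertices P m \ vertices P 0

/-- Two distinct points are neighbours at level `m` if they are vertices of a common cell
of order `m`: within a cell, the vertices form a complete graph. -/
def Neighbour {d : ℕ} (P : Fin d → Space d) (m : ℕ) (X Y : Space d) : Prop :=
  ∃ w : List (Fin d), w.length = m ∧
    ∃ i j : Fin d, i ≠ j ∧ X = wordMap P w (P i) ∧ Y = wordMap P w (P j)

/-- The Sierpinski simplex, as the closure of the union of all vertex sets; it is the unique
nonempty compact set that is the union of its images under the contractions
(`simplex_nonempty`, `simplex_isCompact`, `simplex_eq_iUnion`, `simplex_unique`). -/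
def simplex {d : ℕ} (P : Fin d → Space d) : Set (Space d) :=
  closure (⋃ m : ℕ, (vertices P m : Set (Space d)))

theorem mem_vertices_succ {d : ℕ} (P : Fin d → Space d) (m : ℕ) (X : Space d) :
    X ∈ vertices P (m + 1) ↔ ∃ i, ∃ Y ∈ vertices P m, contraction P i Y = X := by
  simp [vertices]

theorem mem_vertices_zero {d : ℕ} (P : Fin d → Space d) (i : Fin d) : P i ∈ vertices P 0 := by
  simp [vertices]

theorem continuous_contraction {d : ℕ} (P : Fin d → Space d) (i : Fin d) :
    Continuous (contraction P i) := by
  unfold contraction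
  fun_prop

theorem dist_contraction {d : ℕ} (P : Fin d → Space d) (i : Fin d) (X Y : Space d) :
    dist (contraction P i X) (contraction P i Y) = 2⁻¹ * dist X Y := by
  unfold contraction
  rw [dist_smul₀, dist_add_right]
  norm_num

theorem contraction_self {d : ℕ} (P : Fin d → Space d) (i : Fin d) :
    contraction P i (P i) = P i := by
  unfold contraction
  rw [← two_smul ℝ (P i), smul_smul]
  norm_num

theorem simplex_nonempty {d : ℕ} (hd : 1 ≤ d) (P : Fin d → Space d) : (simplex P).Nonempty :=
  ⟨P ⟨0, hd⟩, subset_closure (mem_iUnion.2 ⟨0, mem_vertices_zero P _⟩)⟩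

theorem simplex_isCompact {d : ℕ} (P : Fin d → Space d) : IsCompact (simplex P) := by
  have hK : IsCompact (convexHull ℝ (range P)) := (finite_range P).isCompact_convexHull ℝ
  refine hK.of_isClosed_subset isClosed_closure (closure_minimal ?_ hK.isClosed)
  refine iUnion_subset fun m => ?_
  induction m with
  | zero =>
    intro X hX
    simp only [vertices, Finset.coe_image, Finset.coe_univ, image_univ] at hX
    exact subset_convexHull ℝ _ hX
  | succ m ih =>
    intro X hX
    obtain ⟨i, Y, hY, rfl⟩ := (mem_vertices_succ P m X).1 hX
    have h := (convex_convexHull ℝ (range P)) (ih hY)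
      (subset_convexHull ℝ _ (mem_range_self i)) (a := 2⁻¹) (b := 2⁻¹)
      (by norm_num) (by norm_num) (by norm_num)
    rwa [← smul_add] at h

theorem simplex_eq_iUnion {d : ℕ} (P : Fin d → Space d) :
    simplex P = ⋃ i, contraction P i '' simplex P := by
  apply Subset.antisymm
  · refine closure_minimal ?_ (isClosed_iUnion_of_finite fun i =>
      ((simplex_isCompact P).image (continuous_contraction P i)).isClosed)
    refine iUnion_subset fun m X hX => ?_
    cases m with
    | zero =>
      simp only [vertices, Finset.coe_image, Finset.coe_univ, image_univ] at hX
      obtain ⟨i, rfl⟩ := hX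
      exact mem_iUnion.2 ⟨i, P i, subset_closure (mem_iUnion.2 ⟨0, mem_vertices_zero P i⟩),
        contraction_self P i⟩
    | succ m =>
      obtain ⟨i, Y, hY, rfl⟩ := (mem_vertices_succ P m X).1 hX
      exact mem_iUnion.2 ⟨i, Y, subset_closure (mem_iUnion.2 ⟨m, hY⟩), rfl⟩
  · refine iUnion_subset fun i => ?_
    refine (image_closure_subset_closure_image (continuous_contraction P i)).trans
      (closure_mono ?_)
    rintro _ ⟨Y, hY, rfl⟩
    obtain ⟨m, hm⟩ := mem_iUnion.1 hY
    exact mem_iUnion.2 ⟨m + 1, (mem_vertices_succ P m _).2 ⟨i, Y, hm, rfl⟩⟩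

theorem simplex_unique {d : ℕ} (hd : 1 ≤ d) (P : Fin d → Space d) (K : Set (Space d))
    (hK : IsCompact K) (hne : K.Nonempty) (h : K = ⋃ i, contraction P i '' K) :
    K = simplex P := by
  have hmaps : ∀ i, ∀ X ∈ K, contraction P i X ∈ K := fun i X hX => by
    rw [h]; exact mem_iUnion.2 ⟨i, X, hX, rfl⟩
  apply Subset.antisymm
  · obtain ⟨X₀, hX₀, hmax⟩ := hK.exists_isMaxOn hne
      (Metric.continuous_infDist_pt (simplex P)).continuousOn
    have hle : Metric.infDist X₀ (simplex P) ≤ 2⁻¹ * Metric.infDist X₀ (simplex P) := by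
      have hX₀' := hX₀
      rw [h] at hX₀'
      obtain ⟨i, Y, hY, hYX⟩ := mem_iUnion.1 hX₀'
      obtain ⟨Z, hZ, hYZ⟩ := (simplex_isCompact P).exists_infDist_eq_dist
        (simplex_nonempty hd P) Y
      have hZ' : contraction P i Z ∈ simplex P := by
        rw [simplex_eq_iUnion P]; exact mem_iUnion.2 ⟨i, Z, hZ, rfl⟩
      have h1 := Metric.infDist_le_dist_of_mem (x := X₀) hZ'
      rw [← hYX, dist_contraction, ← hYZ] at h1
      have h2 : Metric.infDist Y (simplex P) ≤ Metric.infDist X₀ (simplex P) := hmax hY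
      rw [← hYX] at h2 ⊢
      linarith
    intro X hX
    have h0 := Metric.infDist_nonneg (x := X) (s := simplex P)
    have h3 : Metric.infDist X (simplex P) ≤ Metric.infDist X₀ (simplex P) := hmax hX
    have h5 : Metric.infDist X (simplex P) = 0 := by linarith
    exact (isClosed_closure.mem_iff_infDist_zero (simplex_nonempty hd P)).2 h5
  · refine closure_minimal (iUnion_subset fun m => ?_) hK.isClosed
    induction m with
    | zero =>
      intro X hX
      simp only [vertices, Finset.coe_image, Finset.coe_univ, image_univ] at hX
      obtain ⟨i, rfl⟩ := hX
      obtain ⟨Z, hZ, hmin⟩ := hK.exists_isMinOn hne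
        (f := fun Z => dist Z (P i)) (by fun_prop)
      have h1 : dist Z (P i) ≤ dist (contraction P i Z) (P i) := hmin (hmaps i Z hZ)
      have h2 := dist_contraction P i Z (P i)
      rw [contraction_self] at h2
      have h4 := dist_nonneg (x := Z) (y := P i)
      have h3 : dist Z (P i) = 0 := by linarith
      rwa [← dist_eq_zero.1 h3]
    | succ m ih =>
      intro X hX
      obtain ⟨i, Y, hY, rfl⟩ := (mem_vertices_succ P m X).1 hX
      exact hmaps i Y (ih hY)

open scoped Classical in
/-- The graph Laplacian of level `m`: the sum over the neighbours `Y` of `X` of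
`f Y - f X`. -/
def graphLaplacian {d : ℕ} (P : Fin d → Space d) (m : ℕ) (f : Space d → ℝ) (X : Space d) : ℝ :=
  ∑ Y ∈ (vertices P m).filter (fun Y => Neighbour P m X Y), (f Y - f X)

/-- The normalization of the graph Laplacian of level `m`. With `r = d / (d + 2)`, and with
`2 / d * d⁻ᵐ` the integral of the harmonic spline that takes the value 1 at one interior vertex
of level `m` and 0 at the other ones, `r⁻ᵐ` divided by this integral is `d / 2 * (d + 2) ^ m`. -/
def normalization (d m : ℕ) : ℝ := (d : ℝ) / 2 * ((d : ℝ) + 2) ^ m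

/-- `f` is in the domain of the Laplacian of the Sierpinski simplex, and `F` is its Laplacian:
both are continuous, and the normalized graph Laplacians of `f` at `x m` converge to `F X` for
every sequence of interior vertices `x m` of level `m` that converges to `X`. -/
structure HasLaplacian {d : ℕ} (P : Fin d → Space d) (f F : Space d → ℝ) : Prop where
  continuousOn : ContinuousOn f (simplex P)
  continuousOn_laplacian : ContinuousOn F (simplex P)
  tendsto : ∀ X ∈ simplex P, ∀ x : ℕ → Space d,
    (∀ m, 1 ≤ m → x m ∈ interiorVertices P m) → Tendsto x atTop (𝓝 X) →
      Tendsto (fun m => normalization d m * graphLaplacian P m f (x m)) atTop (𝓝 (F X))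

/-- `u` solves the heat equation on the Sierpinski simplex on the time interval `]0, T[`, with
value zero on the boundary `V 0` and initial value `g`. -/
structure IsHeatSolution {d : ℕ} (P : Fin d → Space d) (T : ℝ) (g : Space d → ℝ)
    (u : ℝ → Space d → ℝ) : Prop where
  heat : ∀ t ∈ Ioo 0 T, ∃ F : Space d → ℝ, HasLaplacian P (u t) F ∧
    ∀ X ∈ simplex P, HasDerivAt (fun s => u s X) (F X) t
  boundary : ∀ t ∈ Ico 0 T, ∀ X ∈ vertices P 0, u t X = 0
  initial : ∀ X ∈ simplex P, u 0 X = g X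

/-- On `[0, T]`, `u` is twice differentiable with respect to time, with a second derivative that
is bounded uniformly in time and space. -/
def HasBoundedSecondTimeDeriv {d : ℕ} (P : Fin d → Space d) (T : ℝ)
    (u : ℝ → Space d → ℝ) : Prop :=
  ∃ (u' u'' : ℝ → Space d → ℝ) (M : ℝ), ∀ X ∈ simplex P, ∀ t ∈ Icc 0 T,
    HasDerivWithinAt (fun s => u s X) (u' t X) (Icc 0 T) t ∧
    HasDerivWithinAt (fun s => u' s X) (u'' t X) (Icc 0 T) t ∧
    |u'' t X| ≤ M

/-- `f` is Hölder continuous on the Sierpinski simplex, with exponent `α`. -/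
def IsHolder {d : ℕ} (P : Fin d → Space d) (α : ℝ) (f : Space d → ℝ) : Prop :=
  ∃ C : ℝ, ∀ X ∈ simplex P, ∀ Y ∈ simplex P, |f X - f Y| ≤ C * ‖X - Y‖ ^ α

/-- `U k X`, for `k ≤ N` and `X` in `V m`, satisfies the implicit Euler scheme with time step `h`
and initial data `g`. -/
structure IsImplicitEuler {d : ℕ} (P : Fin d → Space d) (m : ℕ) (h : ℝ) (N : ℕ)
    (g : Space d → ℝ) (U : ℕ → Space d → ℝ) : Prop where
  step : ∀ k < N, ∀ X ∈ interiorVertices P m,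
    (U (k + 1) X - U k X) / h = normalization d m * graphLaplacian P m (U (k + 1)) X
  boundary : ∀ k ≤ N, ∀ X ∈ vertices P 0, U k X = 0
  initial : ∀ X ∈ interiorVertices P m, U 0 X = g X

/-- The vector of the values of `f` at the interior vertices of level `m`. -/
def interiorVector {d : ℕ} (P : Fin d → Space d) (m : ℕ) (f : Space d → ℝ) :
    interiorVertices P m → ℝ := fun X => f X

open scoped Classical in
/-- The normalized Laplacian matrix on `V m \ V 0`: before normalization, the diagonal entry is
the number of neighbours in `V m`, and the entry at a pair of neighbours is `-1`. -/
def laplacianMatrix {d : ℕ} (P : Fin d → Space d) (m : ℕ) :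
    Matrix (interiorVertices P m) (interiorVertices P m) ℝ :=
  Matrix.of fun X Y => normalization d m *
    if X = Y then (((vertices P m).filter (fun Z => Neighbour P m X Z)).card : ℝ)
    else if Neighbour P m X Y then -1 else 0

open scoped Classical in
/-- The matrix `I + h Δ` of the implicit Euler scheme. -/
def eulerMatrix {d : ℕ} (P : Fin d → Space d) (m : ℕ) (h : ℝ) :
    Matrix (interiorVertices P m) (interiorVertices P m) ℝ :=
  1 + h • laplacianMatrix P m

/-- The norm `‖w‖_{2,∞}`, the maximum over `0 ≤ k ≤ N` of the square root of
`d⁻ᵐ * ∑ X ∈ V m, |w k X| ^ 2`. -/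
def normTwoInfty {d : ℕ} (P : Fin d → Space d) (m N : ℕ) (w : ℕ → Space d → ℝ) : ℝ :=
  (Finset.range (N + 1)).sup' Finset.nonempty_range_add_one fun k =>
    √(((d : ℝ) ^ m)⁻¹ * ∑ X ∈ vertices P m, |w k X| ^ 2)

end SierpinskiHeat

end

/- The norm of a matrix is the operator norm induced by the sup norm of vectors. -/
attribute [local instance] Matrix.linftyOpNormedAddCommGroup

/-!
Along a cell of order `m`, the sum of the differences `f Y - f X` over the vertices `Y` of the cell
is related to its analogue for the subcell at `X` by summation by parts against the harmonic spline
of the corner `X`; the weights of this spline at the midpoints of the edges are `1`, or `2` at the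
edges through `X`, up to the factor `d + 2`. Hence the normalized graph Laplacian of level `m` at
`X` is a convex combination of normalized graph Laplacians of level `m + 1` at nearby vertices, and
following the larger values one reaches, in the limit, a value of the continuous Laplacian. So the
normalized graph Laplacians are bounded by the Laplacian, and a function with bounded Laplacian
that vanishes on the boundary oscillates at most by a multiple of `(d / (d + 2)) ^ m` on a cell of
order `m`. Applied to the increments in time of a solution `u` of the heat equation, this shows
that `∂ₜ u = Δ u` itself oscillates at most by a multiple of `(d / (d + 2)) ^ m`, which is the
consistency error of the space discretization. Stability is the maximum principle for the graph
Laplacian.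

The Hölder exponent enters only through a dichotomy. If `2⁻¹ ^ α ≥ d / (d + 2)`, the bound above is
better than the one claimed. If `2⁻¹ ^ α < d / (d + 2)`, the sums of differences at a corner decay
too fast for the recursion unless the Laplacian is zero, so the solution vanishes.
-/

noncomputable section

namespace SierpinskiHeat

variable {d : ℕ} {P : Fin d → Space d}

section Cells

theorem contraction_injective (P : Fin d → Space d) (i : Fin d) :
    Function.Injective (contraction P i) := fun _ _ h =>
  add_right_cancel (smul_right_injective _ (inv_ne_zero (two_ne_zero' ℝ)) h)

theorem contraction_comm (P : Fin d → Space d) (i j : Fin d) :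
    contraction P i (P j) = contraction P j (P i) := by
  simp only [contraction, add_comm]

theorem wordMap_cons (P : Fin d → Space d) (i : Fin d) (w : List (Fin d)) (X : Space d) :
    wordMap P (i :: w) X = contraction P i (wordMap P w X) := rfl

theorem wordMap_append (P : Fin d → Space d) (v w : List (Fin d)) (X : Space d) :
    wordMap P (v ++ w) X = wordMap P v (wordMap P w X) := by
  induction v with
  | nil => rfl
  | cons i v ih => rw [List.cons_append, wordMap_cons, ih, wordMap_cons]

theorem wordMap_concat (P : Fin d → Space d) (w : List (Fin d)) (i : Fin d) (X : Space d) :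
    wordMap P (w ++ [i]) X = wordMap P w (contraction P i X) := wordMap_append P w [i] X

theorem wordMap_replicate_self (P : Fin d → Space d) (n : ℕ) (c : Fin d) :
    wordMap P (List.replicate n c) (P c) = P c := by
  induction n with
  | zero => rfl
  | succ n ih => rw [List.replicate_succ, wordMap_cons, ih, contraction_self]

theorem wordMap_injective (P : Fin d → Space d) (w : List (Fin d)) :
    Function.Injective (wordMap P w) := by
  induction w with
  | nil => exact Function.injective_id
  | cons i w ih => exact (contraction_injective P i).comp ih

theorem dist_wordMap (P : Fin d → Space d) (w : List (Fin d)) (X Y : Space d) :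
    dist (wordMap P w X) (wordMap P w Y) = 2⁻¹ ^ w.length * dist X Y := by
  induction w with
  | nil => simp [wordMap]
  | cons i w ih =>
    rw [wordMap_cons, wordMap_cons, dist_contraction, ih, List.length_cons, pow_succ', mul_assoc]

theorem vertices_subset_simplex (P : Fin d → Space d) (m : ℕ) :
    (vertices P m : Set (Space d)) ⊆ simplex P :=
  fun _ hX => subset_closure (mem_iUnion.2 ⟨m, hX⟩)

theorem apply_mem_simplex (P : Fin d → Space d) (i : Fin d) : P i ∈ simplex P :=
  vertices_subset_simplex P 0 (mem_vertices_zero P i)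

theorem contraction_mem_simplex {X : Space d} (hX : X ∈ simplex P) (i : Fin d) :
    contraction P i X ∈ simplex P := by
  rw [simplex_eq_iUnion P]
  exact mem_iUnion.2 ⟨i, X, hX, rfl⟩

theorem wordMap_mem_simplex {X : Space d} (hX : X ∈ simplex P) (w : List (Fin d)) :
    wordMap P w X ∈ simplex P := by
  induction w with
  | nil => exact hX
  | cons i w ih => exact contraction_mem_simplex ih i

theorem exists_mem_wordMap_image_simplex {X : Space d} (hX : X ∈ simplex P) (n : ℕ) :
    ∃ w : List (Fin d), w.length = n ∧ X ∈ wordMap P w '' simplex P := by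
  induction n generalizing X with
  | zero => exact ⟨[], rfl, X, hX, rfl⟩
  | succ n ih =>
    rw [simplex_eq_iUnion P] at hX
    obtain ⟨i, Y, hY, rfl⟩ := mem_iUnion.1 hX
    obtain ⟨w, hw, Z, hZ, rfl⟩ := ih hY
    exact ⟨i :: w, by rw [List.length_cons, hw], Z, hZ, rfl⟩

theorem dist_wordMap_le {X Y : Space d} (hX : X ∈ simplex P) (hY : Y ∈ simplex P)
    (w : List (Fin d)) :
    dist (wordMap P w X) (wordMap P w Y) ≤ Metric.diam (simplex P) / 2 ^ w.length := by
  rw [dist_wordMap, inv_pow, inv_mul_eq_div]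
  gcongr
  exact Metric.dist_le_diam_of_mem (simplex_isCompact P).isBounded hX hY

theorem mem_interiorVertices {m : ℕ} {X : Space d} :
    X ∈ interiorVertices P m ↔ X ∈ vertices P m ∧ X ∉ vertices P 0 := by
  rw [interiorVertices, Finset.mem_sdiff]

theorem mem_simplex_of_mem_interiorVertices {m : ℕ} {X : Space d}
    (hX : X ∈ interiorVertices P m) : X ∈ simplex P :=
  vertices_subset_simplex P m (mem_interiorVertices.1 hX).1

theorem mem_vertices_zero_iff {X : Space d} : X ∈ vertices P 0 ↔ ∃ i, P i = X := by
  simp [vertices]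

theorem card_vertices_le (P : Fin d → Space d) (m : ℕ) :
    (vertices P m).card ≤ d ^ (m + 1) := by
  induction m with
  | zero => simpa [vertices] using Finset.card_image_le (s := Finset.univ) (f := P)
  | succ m ih =>
    refine Finset.card_biUnion_le.trans ?_
    refine (Finset.sum_le_card_nsmul _ _ _ fun i _ => Finset.card_image_le.trans ih).trans_eq ?_
    rw [Finset.card_univ, Fintype.card_fin, smul_eq_mul, ← pow_succ']

end Cells

section Barycentric

theorem exists_affineBasis [NeZero d] (hP : AffineIndependent ℝ P) :
    ∃ b : AffineBasis (Fin d) ℝ (Space d), ⇑b = P := by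
  refine ⟨⟨P, hP, ?_⟩, rfl⟩
  rw [hP.affineSpan_eq_top_iff_card_eq_finrank_add_one, Fintype.card_fin,
    finrank_euclideanSpace_fin, Nat.sub_add_cancel NeZero.one_le]

theorem coord_contraction (b : AffineBasis (Fin d) ℝ (Space d)) (i k : Fin d) (X : Space d) :
    b.coord k (contraction b i X) = 2⁻¹ * (b.coord k X + if k = i then 1 else 0) := by
  have h : contraction b i X = AffineMap.lineMap X (b i) (2⁻¹ : ℝ) := by
    simp only [contraction, AffineMap.lineMap_apply, vsub_eq_sub, vadd_eq_add]
    module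
  rw [h, AffineMap.apply_lineMap, AffineBasis.coord_apply, AffineMap.lineMap_apply]
  simp only [vsub_eq_sub, vadd_eq_add, smul_eq_mul]
  ring

theorem coord_le_one {ι V : Type*} [Finite ι] [AddCommGroup V] [Module ℝ V]
    (b : AffineBasis ι ℝ V) {X : V} (hX : ∀ k, 0 ≤ b.coord k X) (i : ι) : b.coord i X ≤ 1 := by
  cases nonempty_fintype ι
  rw [← b.sum_coord_apply_eq_one X]
  exact Finset.single_le_sum (f := fun k => b.coord k X) (fun k _ => hX k) (Finset.mem_univ i)

theorem eq_of_one_le_coord {ι V : Type*} [Finite ι] [AddCommGroup V] [Module ℝ V]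
    (b : AffineBasis ι ℝ V) {X : V} (hX : ∀ k, 0 ≤ b.coord k X) {i : ι} (h : 1 ≤ b.coord i X) :
    X = b i := by
  classical
  cases nonempty_fintype ι
  have hi : b.coord i X = 1 := (coord_le_one b hX i).antisymm h
  have hsum : ∑ k ∈ Finset.univ.erase i, b.coord k X = 0 := by
    rw [Finset.sum_erase_eq_sub (Finset.mem_univ i), b.sum_coord_apply_eq_one, hi, sub_self]
  rw [Finset.sum_eq_zero_iff_of_nonneg fun k _ => hX k] at hsum
  refine b.ext_elem fun k => ?_
  rcases eq_or_ne k i with rfl | hk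
  · rw [hi, b.coord_apply_eq]
  · rw [hsum k (Finset.mem_erase.2 ⟨hk, Finset.mem_univ k⟩), b.coord_apply_ne hk]

theorem apply_mem_convexHull (P : Fin d → Space d) (i : Fin d) :
    P i ∈ convexHull ℝ (range P) :=
  subset_convexHull ℝ _ (mem_range_self i)

theorem contraction_mem_convexHull {X : Space d} (hX : X ∈ convexHull ℝ (range P)) (i : Fin d) :
    contraction P i X ∈ convexHull ℝ (range P) := by
  have h := convex_convexHull ℝ (range P) hX (apply_mem_convexHull P i) (a := 2⁻¹) (b := 2⁻¹)
    (by norm_num) (by norm_num) (by norm_num)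
  rwa [← smul_add] at h

theorem wordMap_mem_convexHull {X : Space d} (hX : X ∈ convexHull ℝ (range P))
    (w : List (Fin d)) : wordMap P w X ∈ convexHull ℝ (range P) := by
  induction w with
  | nil => exact hX
  | cons i w ih => exact contraction_mem_convexHull ih i

theorem eq_of_contraction_eq_contraction (hP : AffineIndependent ℝ P) {X Y : Space d}
    (hX : X ∈ convexHull ℝ (range P)) (hY : Y ∈ convexHull ℝ (range P)) {i j : Fin d}
    (hij : i ≠ j) (h : contraction P i X = contraction P j Y) : X = P j ∧ Y = P i := by
  have : NeZero d := ⟨i.pos.ne'⟩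
  obtain ⟨b, rfl⟩ := exists_affineBasis hP
  rw [b.convexHull_eq_nonneg_coord] at hX hY
  -- Coordinate `j` is at most `1/2` at `contraction b i X` and at least `1/2` at
  -- `contraction b j Y`; likewise for `i`.
  have hi := congrArg (b.coord i) h
  have hj := congrArg (b.coord j) h
  simp only [coord_contraction, if_true, if_neg hij, if_neg hij.symm] at hi hj
  exact ⟨eq_of_one_le_coord b hX (by linarith [coord_le_one b hY i, hY j]),
    eq_of_one_le_coord b hY (by linarith [coord_le_one b hX j, hX i])⟩

theorem eq_of_contraction_eq_apply (hP : AffineIndependent ℝ P) {X : Space d}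
    (hX : X ∈ convexHull ℝ (range P)) {i c : Fin d} (h : contraction P i X = P c) :
    i = c ∧ X = P c := by
  rw [← contraction_self P c] at h
  have hic : i = c := by
    by_contra hic
    exact hic (hP.injective
      (eq_of_contraction_eq_contraction hP hX (apply_mem_convexHull P c) hic h).2.symm)
  subst hic
  exact ⟨rfl, contraction_injective P i h⟩

theorem eq_of_wordMap_eq_apply (hP : AffineIndependent ℝ P) {X : Space d}
    (hX : X ∈ convexHull ℝ (range P)) {w : List (Fin d)} {c : Fin d}
    (h : wordMap P w X = P c) : w = List.replicate w.length c ∧ X = P c := by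
  induction w with
  | nil => exact ⟨rfl, h⟩
  | cons i w ih =>
    obtain ⟨rfl, h'⟩ := eq_of_contraction_eq_apply hP (wordMap_mem_convexHull hX w) h
    obtain ⟨hw, hXc⟩ := ih h'
    exact ⟨by rw [List.length_cons, List.replicate_succ, ← hw], hXc⟩

theorem eq_of_common_vertices (hP : AffineIndependent ℝ P) {w w' : List (Fin d)}
    (hl : w.length = w'.length) (hw : w ≠ w') {i i' k k' : Fin d}
    (hi : wordMap P w (P i) = wordMap P w' (P i'))
    (hk : wordMap P w (P k) = wordMap P w' (P k')) : i = k := by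
  induction w generalizing w' with
  | nil => exact absurd (List.length_eq_zero_iff.1 hl.symm).symm hw
  | cons a w ih =>
    obtain ⟨b, w', rfl⟩ := List.exists_cons_of_length_eq_add_one hl.symm
    rcases eq_or_ne a b with rfl | hab
    · exact ih (by simpa using hl) (fun h => hw (by rw [h])) (contraction_injective P a hi)
        (contraction_injective P a hk)
    · have eq_corner {j j'} (h : wordMap P (a :: w) (P j) = wordMap P (b :: w') (P j')) :
          wordMap P w (P j) = P b :=
        (eq_of_contraction_eq_contraction hP (wordMap_mem_convexHull (apply_mem_convexHull P _) _)
          (wordMap_mem_convexHull (apply_mem_convexHull P _) _) hab h).1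
      exact hP.injective (wordMap_injective P w ((eq_corner hi).trans (eq_corner hk).symm))

end Barycentric

section Addresses

/-- The pairs of a word `w` of length `n` and an index `i` such that `X` is the vertex `i` of the
cell with word `w`. -/
def addresses (P : Fin d → Space d) (n : ℕ) (X : Space d) : Set (List (Fin d) × Fin d) :=
  {a | a.1.length = n ∧ wordMap P a.1 (P a.2) = X}

theorem mem_addresses {n : ℕ} {X : Space d} {w : List (Fin d)} {i : Fin d} :
    (w, i) ∈ addresses P n X ↔ w.length = n ∧ wordMap P w (P i) = X := Iff.rfl

theorem cons_mem_addresses_contraction {n : ℕ} {X : Space d} {a i : Fin d} {w : List (Fin d)} :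
    (a :: w, i) ∈ addresses P (n + 1) (contraction P a X) ↔ (w, i) ∈ addresses P n X := by
  rw [mem_addresses, mem_addresses, List.length_cons, Nat.succ_inj, wordMap_cons,
    (contraction_injective P a).eq_iff]

theorem mem_vertices_iff {m : ℕ} {X : Space d} :
    X ∈ vertices P m ↔ ∃ w i, (w, i) ∈ addresses P m X := by
  induction m generalizing X with
  | zero =>
    simp only [mem_vertices_zero_iff, mem_addresses, List.length_eq_zero_iff, exists_and_left,
      exists_eq_left, wordMap, id]
  | succ m ih =>
    rw [mem_vertices_succ]
    constructor
    · rintro ⟨a, Y, hY, rfl⟩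
      obtain ⟨w, i, h⟩ := ih.1 hY
      exact ⟨a :: w, i, cons_mem_addresses_contraction.2 h⟩
    · rintro ⟨_ | ⟨a, w⟩, i, hw, rfl⟩
      · exact absurd hw (Nat.succ_ne_zero m).symm
      · exact ⟨a, wordMap P w (P i), ih.2 ⟨w, i, Nat.succ_inj.1 hw, rfl⟩, rfl⟩

theorem wordMap_apply_mem_vertices (P : Fin d → Space d) (w : List (Fin d)) (i : Fin d) :
    wordMap P w (P i) ∈ vertices P w.length :=
  mem_vertices_iff.2 ⟨w, i, rfl, rfl⟩

theorem addresses_apply (hP : AffineIndependent ℝ P) (n : ℕ) (c : Fin d) :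
    addresses P n (P c) = {(List.replicate n c, c)} := by
  ext ⟨w, i⟩
  rw [mem_addresses, Set.mem_singleton_iff, Prod.mk.injEq]
  constructor
  · rintro ⟨rfl, h⟩
    obtain ⟨hw, hi⟩ := eq_of_wordMap_eq_apply hP (apply_mem_convexHull P i) h
    exact ⟨hw, hP.injective hi⟩
  · rintro ⟨rfl, rfl⟩
    exact ⟨List.length_replicate, wordMap_replicate_self P n i⟩

theorem addresses_contraction_apply (hP : AffineIndependent ℝ P) (n : ℕ) {a b : Fin d}
    (hab : a ≠ b) : addresses P (n + 1) (contraction P a (P b)) =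
      {(a :: List.replicate n b, b), (b :: List.replicate n a, a)} := by
  have mem_iff {c e : Fin d} (w : List (Fin d)) (i : Fin d) :
      (c :: w, i) ∈ addresses P (n + 1) (contraction P c (P e)) ↔
        w = List.replicate n e ∧ i = e := by
    rw [cons_mem_addresses_contraction, addresses_apply hP, Set.mem_singleton_iff, Prod.mk.injEq]
  apply Subset.antisymm
  · rintro ⟨_ | ⟨c, w⟩, i⟩ h
    · exact absurd h.1 (Nat.succ_ne_zero n).symm
    · rcases eq_or_ne c a with rfl | hca
      · obtain ⟨rfl, rfl⟩ := (mem_iff w i).1 h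
        exact Or.inl rfl
      · have hcb : b = c := hP.injective (eq_of_contraction_eq_contraction hP
          (wordMap_mem_convexHull (apply_mem_convexHull P i) w) (apply_mem_convexHull P b) hca
          h.2).2
        subst hcb
        rw [contraction_comm] at h
        obtain ⟨rfl, rfl⟩ := (mem_iff w i).1 h
        exact Or.inr rfl
  · rintro _ (rfl | rfl)
    · exact (mem_iff _ _).2 ⟨rfl, rfl⟩
    · rw [contraction_comm]
      exact (mem_iff _ _).2 ⟨rfl, rfl⟩

theorem addresses_contraction (hP : AffineIndependent ℝ P) (n : ℕ) (a : Fin d) {X : Space d}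
    (hX : X ∈ convexHull ℝ (range P)) (hX₀ : X ∉ vertices P 0) :
    addresses P (n + 1) (contraction P a X) = Prod.map (List.cons a) id '' addresses P n X := by
  apply Subset.antisymm
  · rintro ⟨_ | ⟨c, w⟩, i⟩ h
    · exact absurd h.1 (Nat.succ_ne_zero n).symm
    · have hca : c = a := by
        by_contra hca
        have hXc := (eq_of_contraction_eq_contraction hP
          (wordMap_mem_convexHull (apply_mem_convexHull P i) w) hX hca h.2).2
        exact hX₀ (hXc ▸ mem_vertices_zero P c)
      subst hca
      exact ⟨(w, i), cons_mem_addresses_contraction.1 h, rfl⟩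
  · rintro _ ⟨⟨w, i⟩, h, rfl⟩
    exact cons_mem_addresses_contraction.2 h

theorem encard_addresses (hP : AffineIndependent ℝ P) {m : ℕ} {X : Space d}
    (hX : X ∈ interiorVertices P m) : (addresses P m X).encard = 2 := by
  induction m generalizing X with
  | zero => exact absurd (mem_interiorVertices.1 hX).1 (mem_interiorVertices.1 hX).2
  | succ m ih =>
    obtain ⟨hXm, hX₀⟩ := mem_interiorVertices.1 hX
    obtain ⟨a, Y, hY, rfl⟩ := (mem_vertices_succ P m X).1 hXm
    by_cases hY₀ : Y ∈ vertices P 0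
    · obtain ⟨b, rfl⟩ := mem_vertices_zero_iff.1 hY₀
      have hab : a ≠ b := by
        rintro rfl
        exact hX₀ (by rwa [contraction_self])
      rw [addresses_contraction_apply hP m hab, Set.encard_pair]
      simp [hab]
    · obtain ⟨w, i, -, rfl⟩ := mem_vertices_iff.1 hY
      rw [addresses_contraction hP m a (wordMap_mem_convexHull (apply_mem_convexHull P i) w) hY₀,
        ((List.cons_injective).prodMap Function.injective_id).encard_image]
      exact ih (mem_interiorVertices.2 ⟨hY, hY₀⟩)

theorem exists_addresses_eq (hP : AffineIndependent ℝ P) {m : ℕ} {X : Space d}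
    (hX : X ∈ interiorVertices P m) :
    ∃ w i w' i', w ≠ w' ∧ addresses P m X = {(w, i), (w', i')} := by
  obtain ⟨⟨w, i⟩, ⟨w', i'⟩, hne, h⟩ := Set.encard_eq_two.1 (encard_addresses hP hX)
  refine ⟨w, i, w', i', ?_, h⟩
  rintro rfl
  have hi : (w, i) ∈ addresses P m X := h ▸ Set.mem_insert _ _
  have hi' : (w, i') ∈ addresses P m X := h ▸ Set.mem_insert_of_mem _ rfl
  exact hne (congrArg (Prod.mk w)
    (hP.injective (wordMap_injective P w (hi.2.trans hi'.2.symm))))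

theorem addresses_eq_pair (hP : AffineIndependent ℝ P) {m : ℕ} {X : Space d}
    (hX : X ∉ vertices P 0) {a a' : List (Fin d) × Fin d} (ha : a ∈ addresses P m X)
    (ha' : a' ∈ addresses P m X) (hne : a ≠ a') : addresses P m X = {a, a'} := by
  have hcard := encard_addresses hP
    (mem_interiorVertices.2 ⟨mem_vertices_iff.2 ⟨a.1, a.2, ha⟩, hX⟩)
  refine ((Set.toFinite {a, a'}).eq_of_subset_of_encard_le
    (Set.insert_subset ha (Set.singleton_subset_iff.2 ha')) ?_).symm
  rw [hcard, Set.encard_pair hne]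

theorem two_le_of_mem_interiorVertices {m : ℕ} {X : Space d} (hX : X ∈ interiorVertices P m) :
    2 ≤ d := by
  obtain ⟨hXm, hX₀⟩ := mem_interiorVertices.1 hX
  obtain ⟨w, i, -, rfl⟩ := mem_vertices_iff.1 hXm
  by_contra! hd
  have : Subsingleton (Fin d) := Fin.subsingleton_iff_le_one.2 (Nat.lt_succ_iff.1 hd)
  have hw : w = List.replicate w.length i :=
    List.eq_replicate_of_mem fun _ _ => Subsingleton.elim _ _
  rw [hw, wordMap_replicate_self] at hX₀
  exact hX₀ (mem_vertices_zero P i)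

theorem not_neighbour_self (hP : Function.Injective P) (m : ℕ) (X : Space d) :
    ¬ Neighbour P m X X := by
  rintro ⟨w, -, i, j, hij, hi, hj⟩
  exact hij (hP (wordMap_injective P w (hi.symm.trans hj)))

end Addresses

section CornerSum

open scoped Classical in
/-- The vertices of the cell with word `w`, except the vertex `i`. -/
def otherVertices (P : Fin d → Space d) (w : List (Fin d)) (i : Fin d) : Finset (Space d) :=
  (Finset.univ.erase i).image fun k => wordMap P w (P k)

theorem mem_otherVertices {w : List (Fin d)} {i : Fin d} {Y : Space d} :
    Y ∈ otherVertices P w i ↔ ∃ k, k ≠ i ∧ wordMap P w (P k) = Y := by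
  simp only [otherVertices, Finset.mem_image, Finset.mem_erase, Finset.mem_univ, and_true]

/-- The sum of the differences between the values of `f` at the vertices of the cell with word `w`
and its value at the vertex `i` of this cell. It is the contribution of the cell to the graph
Laplacian at this vertex. -/
def cornerSum (P : Fin d → Space d) (f : Space d → ℝ) (w : List (Fin d)) (i : Fin d) : ℝ :=
  ∑ k, (f (wordMap P w (P k)) - f (wordMap P w (P i)))

theorem sum_cornerSum (P : Fin d → Space d) (f : Space d → ℝ) (w : List (Fin d)) :
    ∑ i, cornerSum P f w i = 0 := by
  simp only [cornerSum, Finset.sum_sub_distrib, Finset.sum_const, ← Finset.smul_sum, sub_self]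

theorem sum_otherVertices (hP : Function.Injective P) (f : Space d → ℝ) (w : List (Fin d))
    (i : Fin d) :
    ∑ Y ∈ otherVertices P w i, (f Y - f (wordMap P w (P i))) = cornerSum P f w i := by
  classical
  rw [otherVertices, Finset.sum_image fun j _ k _ h => hP (wordMap_injective P w h)]
  exact Finset.sum_erase _ (sub_self _)

open scoped Classical in
theorem filter_neighbour_eq_union {m : ℕ} {X : Space d} {w w' : List (Fin d)} {i i' : Fin d}
    (h : addresses P m X = {(w, i), (w', i')}) :
    (vertices P m).filter (Neighbour P m X) = otherVertices P w i ∪ otherVertices P w' i' := by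
  have hw : (w, i) ∈ addresses P m X := h ▸ Set.mem_insert _ _
  have hw' : (w', i') ∈ addresses P m X := h ▸ Set.mem_insert_of_mem _ rfl
  have mem_filter {u : List (Fin d)} {j k : Fin d} (hu : (u, j) ∈ addresses P m X) (hk : k ≠ j) :
      wordMap P u (P k) ∈ (vertices P m).filter (Neighbour P m X) :=
    Finset.mem_filter.2 ⟨hu.1 ▸ wordMap_apply_mem_vertices P u k, u, hu.1, j, k, hk.symm,
      hu.2.symm, rfl⟩
  ext Y
  rw [Finset.mem_union, mem_otherVertices, mem_otherVertices]
  constructor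
  · intro hY
    obtain ⟨u, hu, j, k, hjk, hj, rfl⟩ := (Finset.mem_filter.1 hY).2
    have huj : (u, j) ∈ addresses P m X := ⟨hu, hj.symm⟩
    rcases h ▸ huj with huj | huj <;> obtain ⟨rfl, rfl⟩ := Prod.mk.inj huj
    · exact Or.inl ⟨k, hjk.symm, rfl⟩
    · exact Or.inr ⟨k, hjk.symm, rfl⟩
  · rintro (⟨k, hk, rfl⟩ | ⟨k, hk, rfl⟩)
    · exact mem_filter hw hk
    · exact mem_filter hw' hk

theorem disjoint_otherVertices (hP : AffineIndependent ℝ P) {m : ℕ} {X : Space d}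
    {w w' : List (Fin d)} {i i' : Fin d} (hw : (w, i) ∈ addresses P m X)
    (hw' : (w', i') ∈ addresses P m X) (hne : w ≠ w') :
    Disjoint (otherVertices P w i) (otherVertices P w' i') := by
  rw [Finset.disjoint_left]
  intro Y hY hY'
  obtain ⟨k, hk, hkY⟩ := mem_otherVertices.1 hY
  obtain ⟨k', -, hkY'⟩ := mem_otherVertices.1 hY'
  exact hk (eq_of_common_vertices hP (hw.1.trans hw'.1.symm) hne (hw.2.trans hw'.2.symm)
    (hkY.trans hkY'.symm)).symm

theorem graphLaplacian_eq_add_cornerSum (hP : AffineIndependent ℝ P) {m : ℕ} {X : Space d}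
    (hX : X ∉ vertices P 0) {w w' : List (Fin d)} {i i' : Fin d} (hw : (w, i) ∈ addresses P m X)
    (hw' : (w', i') ∈ addresses P m X) (hne : w ≠ w') (f : Space d → ℝ) :
    graphLaplacian P m f X = cornerSum P f w i + cornerSum P f w' i' := by
  classical
  have hpair := addresses_eq_pair hP hX hw hw' fun h => hne (congrArg Prod.fst h)
  rw [graphLaplacian, ← sum_otherVertices hP.injective, ← sum_otherVertices hP.injective, hw.2,
    hw'.2, ← Finset.sum_union (disjoint_otherVertices hP hw hw' hne),
    ← filter_neighbour_eq_union hpair]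

end CornerSum

section EdgeMidpoint

/-- The midpoint of the edge from the vertex `j` to the vertex `k` of the cell with word `w`; for
`j = k`, this is the vertex itself. -/
def edgeMidpoint (P : Fin d → Space d) (w : List (Fin d)) (j k : Fin d) : Space d :=
  wordMap P w (contraction P j (P k))

theorem wordMap_concat_apply (P : Fin d → Space d) (w : List (Fin d)) (j k : Fin d) :
    wordMap P (w ++ [j]) (P k) = edgeMidpoint P w j k :=
  wordMap_concat P w j (P k)

theorem edgeMidpoint_self (P : Fin d → Space d) (w : List (Fin d)) (j : Fin d) :
    edgeMidpoint P w j j = wordMap P w (P j) := by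
  rw [edgeMidpoint, contraction_self]

theorem edgeMidpoint_comm (P : Fin d → Space d) (w : List (Fin d)) (j k : Fin d) :
    edgeMidpoint P w j k = edgeMidpoint P w k j := by
  rw [edgeMidpoint, contraction_comm, edgeMidpoint]

theorem concat_mem_addresses_edgeMidpoint (P : Fin d → Space d) (w : List (Fin d)) (j k : Fin d) :
    (w ++ [j], k) ∈ addresses P (w.length + 1) (edgeMidpoint P w j k) :=
  ⟨List.length_append, wordMap_concat_apply P w j k⟩

theorem concat_mem_addresses_succ {m : ℕ} {X : Space d} {w : List (Fin d)} {i : Fin d}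
    (h : (w, i) ∈ addresses P m X) : (w ++ [i], i) ∈ addresses P (m + 1) X := by
  obtain ⟨rfl, rfl⟩ := h
  rw [← edgeMidpoint_self]
  exact concat_mem_addresses_edgeMidpoint P w i i

theorem edgeMidpoint_mem_vertices (P : Fin d → Space d) (w : List (Fin d)) (j k : Fin d) :
    edgeMidpoint P w j k ∈ vertices P (w.length + 1) :=
  mem_vertices_iff.2 ⟨_, _, concat_mem_addresses_edgeMidpoint P w j k⟩

theorem vertices_subset_succ (P : Fin d → Space d) (m : ℕ) : vertices P m ⊆ vertices P (m + 1) := by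
  intro X hX
  obtain ⟨w, i, h⟩ := mem_vertices_iff.1 hX
  exact mem_vertices_iff.2 ⟨_, _, concat_mem_addresses_succ h⟩

theorem edgeMidpoint_mem_interiorVertices (hP : AffineIndependent ℝ P) (w : List (Fin d))
    {j k : Fin d} (hjk : j ≠ k) : edgeMidpoint P w j k ∈ interiorVertices P (w.length + 1) := by
  refine mem_interiorVertices.2 ⟨edgeMidpoint_mem_vertices P w j k, fun h => ?_⟩
  obtain ⟨c, hc⟩ := mem_vertices_zero_iff.1 h
  have hcorner := (eq_of_wordMap_eq_apply hP
    (contraction_mem_convexHull (apply_mem_convexHull P k) j) hc.symm).2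
  obtain ⟨rfl, hk⟩ := eq_of_contraction_eq_apply hP (apply_mem_convexHull P k) hcorner
  exact hjk (hP.injective hk).symm

theorem interiorVertices_nonempty (hd : 2 ≤ d) (hP : AffineIndependent ℝ P) {m : ℕ}
    (hm : 1 ≤ m) : (interiorVertices P m).Nonempty := by
  obtain ⟨n, rfl⟩ := Nat.exists_eq_add_of_le' hm
  let w : List (Fin d) := List.replicate n ⟨0, by omega⟩
  have h := edgeMidpoint_mem_interiorVertices hP w (j := ⟨0, by omega⟩) (k := ⟨1, by omega⟩)
    (by simp)
  rw [List.length_replicate] at h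
  exact ⟨_, h⟩

end EdgeMidpoint

section Spline

/-- The value, at the midpoint of the edge from `j` to `k ≠ j` of a cell, of the harmonic spline
that takes the value 1 at the corner `i` of the cell and 0 at the other ones, multiplied by
`d + 2`. The value is zero for `j = k`, so that sums over pairs are sums over edges. -/
def splineWeight (i j k : Fin d) : ℝ :=
  if j = k then 0 else 1 + (if j = i then 1 else 0) + (if k = i then 1 else 0)

/-- The sum over the edges of a cell, each counted twice, of the values `L j k` with the weights of
the harmonic spline of the corner `i`. -/
def splineSum (i : Fin d) (L : Fin d → Fin d → ℝ) : ℝ :=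
  ∑ j, ∑ k, splineWeight i j k * L j k

theorem splineWeight_self (i j : Fin d) : splineWeight i j j = 0 := if_pos rfl

theorem splineWeight_nonneg (i j k : Fin d) : 0 ≤ splineWeight i j k := by
  unfold splineWeight
  split_ifs <;> norm_num

theorem splineSum_eq (i : Fin d) (L : Fin d → Fin d → ℝ) :
    splineSum i L = ∑ j, ∑ k, L j k + ∑ k, L i k + ∑ j, L j i - ∑ j, L j j - 2 * L i i := by
  have splineWeight_mul (j k : Fin d) (x : ℝ) : splineWeight i j k * x =
      x + (if j = i then x else 0) + (if k = i then x else 0) -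
        (if j = k then (x + (if j = i then x else 0) + (if k = i then x else 0)) else 0) := by
    unfold splineWeight
    split_ifs <;> ring
  simp only [splineSum, splineWeight_mul, Finset.sum_sub_distrib, Finset.sum_add_distrib,
    Finset.sum_ite_eq, Finset.sum_ite_eq', Finset.mem_univ, if_true, Finset.sum_ite_irrel,
    Finset.sum_const_zero]
  ring

theorem splineSum_const (i : Fin d) (c : ℝ) :
    splineSum i (fun _ _ => c) = ((d : ℝ) - 1) * (d + 2) * c := by
  rw [splineSum_eq]
  simp only [Finset.sum_const, Finset.card_univ, Fintype.card_fin, nsmul_eq_mul]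
  ring

theorem splineSum_const_mul (i : Fin d) (c : ℝ) (L : Fin d → Fin d → ℝ) :
    splineSum i (fun j k => c * L j k) = c * splineSum i L := by
  simp only [splineSum, Finset.mul_sum, mul_left_comm]

theorem splineSum_mono (i : Fin d) {L L' : Fin d → Fin d → ℝ}
    (h : ∀ j k, j ≠ k → L j k ≤ L' j k) : splineSum i L ≤ splineSum i L' := by
  refine Finset.sum_le_sum fun j _ => Finset.sum_le_sum fun k _ => ?_
  rcases eq_or_ne j k with rfl | hjk
  · rw [splineWeight_self, zero_mul, zero_mul]
  · exact mul_le_mul_of_nonneg_left (h j k hjk) (splineWeight_nonneg i j k)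

theorem splineSum_congr (i : Fin d) {L L' : Fin d → Fin d → ℝ}
    (h : ∀ j k, j ≠ k → L j k = L' j k) : splineSum i L = splineSum i L' :=
  (splineSum_mono i fun j k hjk => (h j k hjk).le).antisymm
    (splineSum_mono i fun j k hjk => (h j k hjk).ge)

theorem abs_splineSum_le (i : Fin d) {L : Fin d → Fin d → ℝ} {ε : ℝ}
    (hε : ∀ j k, j ≠ k → |L j k| ≤ ε) : |splineSum i L| ≤ ((d : ℝ) - 1) * (d + 2) * ε := by
  have hle := splineSum_mono i fun j k hjk => (abs_le.1 (hε j k hjk)).2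
  have hge := splineSum_mono i fun j k hjk => (abs_le.1 (hε j k hjk)).1
  rw [splineSum_const] at hle hge
  exact abs_le.2 ⟨by linarith, hle⟩

/-- The graph Laplacian of the next level at the midpoint of the edge from `j` to `k` of a cell;
here `q j k` is the value of the function at this midpoint, and `q j j` its value at the
vertex `j`. -/
def edgeLaplacian (q : Fin d → Fin d → ℝ) (j k : Fin d) : ℝ :=
  ∑ l, (q j l - q j k) + ∑ l, (q k l - q j k)

theorem edgeLaplacian_eq (q : Fin d → Fin d → ℝ) (j k : Fin d) :
    edgeLaplacian q j k = ∑ l, q j l + ∑ l, q k l - 2 * d * q j k := by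
  simp only [edgeLaplacian, Finset.sum_sub_distrib, Finset.sum_const, Finset.card_univ,
    Fintype.card_fin, nsmul_eq_mul]
  ring

-- Summation by parts on one cell: the spline of the corner `i` is harmonic at the midpoints.
theorem mul_sum_sub_eq_splineSum {q : Fin d → Fin d → ℝ} (hq : ∀ j k, q j k = q k j) (i : Fin d) :
    d * ∑ k, (q k k - q i i) =
      (d + 2) * ∑ k, (q i k - q i i) + 2⁻¹ * splineSum i (edgeLaplacian q) := by
  have hcol : ∑ j, q j i = ∑ j, q i j := Finset.sum_congr rfl fun j _ => hq j i
  simp only [splineSum_eq, edgeLaplacian_eq, Finset.sum_sub_distrib, Finset.sum_add_distrib,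
    Finset.sum_const, Finset.card_univ, Fintype.card_fin, nsmul_eq_mul, ← Finset.mul_sum, hcol]
  ring

/-- The value, at the midpoint of the edge from `j` to `k ≠ j` of a cell, of the harmonic function
with values `p` at the vertices of the cell. -/
def harmonicValue (p : Fin d → ℝ) (j k : Fin d) : ℝ :=
  (∑ l, p l + p j + p k) / (d + 2)

theorem abs_sub_harmonicValue_le {q : Fin d → Fin d → ℝ} (hq : ∀ j k, q j k = q k j) {ε : ℝ}
    (hε : ∀ j k, j ≠ k → |edgeLaplacian q j k| ≤ ε) {j k : Fin d} (hjk : j ≠ k) :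
    |q j k - harmonicValue (fun l => q l l) j k| ≤ ε / 2 := by
  have hd : (0 : ℝ) < d := by exact_mod_cast j.pos
  set R := fun i => splineSum i (edgeLaplacian q)
  have row_sum (i : Fin d) :
      ∑ k, q i k = (d * ∑ l, q l l + 2 * d * q i i - R i / 2) / (d + 2) := by
    have h := mul_sum_sub_eq_splineSum hq i
    simp only [Finset.sum_sub_distrib, Finset.sum_const, Finset.card_univ, Fintype.card_fin,
      nsmul_eq_mul] at h
    rw [eq_div_iff (by positivity)]
    linarith
  have deviation_eq : q j k - harmonicValue (fun l => q l l) j k =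
      -((R j + R k) / (4 * d * (d + 2)) + edgeLaplacian q j k / (2 * d)) := by
    rw [edgeLaplacian_eq, row_sum, row_sum, harmonicValue]
    field_simp
    ring
  have bound_eq :
      ε / 2 = (2 * (((d : ℝ) - 1) * (d + 2) * ε)) / (4 * d * (d + 2)) + ε / (2 * d) := by
    field_simp
    ring
  rw [deviation_eq, abs_neg, bound_eq]
  refine (abs_add_le _ _).trans ?_
  rw [abs_div, abs_div, abs_of_pos (by positivity : 0 < 4 * (d : ℝ) * (d + 2)),
    abs_of_pos (by positivity : 0 < 2 * (d : ℝ))]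
  gcongr
  · exact (abs_add_le _ _).trans (by linarith [abs_splineSum_le j hε, abs_splineSum_le k hε])
  · exact hε j k hjk

theorem abs_apply_sub_harmonicValue_le {p : Fin d → ℝ} {o : ℝ} {i : Fin d}
    (ho : ∀ l, |p i - p l| ≤ o) (k : Fin d) :
    |p i - harmonicValue p i k| ≤ d / (d + 2) * o := by
  have deviation_eq : p i - harmonicValue p i k =
      ((p i - p k) + ∑ l ∈ Finset.univ.erase i, (p i - p l)) / (d + 2) := by
    rw [harmonicValue, Finset.sum_erase _ (sub_self _), Finset.sum_sub_distrib, Finset.sum_const,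
      Finset.card_univ, Fintype.card_fin, nsmul_eq_mul]
    field_simp
    ring
  have hsum : |∑ l ∈ Finset.univ.erase i, (p i - p l)| ≤ ((d : ℝ) - 1) * o := by
    refine (Finset.abs_sum_le_sum_abs _ _).trans
      ((Finset.sum_le_card_nsmul _ _ o fun l _ => ho l).trans_eq ?_)
    rw [Finset.card_erase_of_mem (Finset.mem_univ i), Finset.card_univ, Fintype.card_fin,
      nsmul_eq_mul, Nat.cast_pred i.pos]
  rw [deviation_eq, abs_div, abs_of_pos (by positivity : (0 : ℝ) < d + 2), div_mul_eq_mul_div]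
  gcongr
  exact (abs_add_le _ _).trans (by linarith [ho k])

theorem abs_harmonicValue_sub_le {p : Fin d → ℝ} {o : ℝ} (i : Fin d) {j k : Fin d}
    (ho : |p j - p k| ≤ o) :
    |harmonicValue p i j - harmonicValue p i k| ≤ d / (d + 2) * o := by
  have hd : (1 : ℝ) ≤ d := by exact_mod_cast i.pos
  rw [harmonicValue, harmonicValue, ← sub_div, add_sub_add_left_eq_sub, abs_div,
    abs_of_pos (by positivity : (0 : ℝ) < d + 2), div_mul_eq_mul_div]
  gcongr
  exact ho.trans (le_mul_of_one_le_left ((abs_nonneg _).trans ho) hd)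

theorem abs_sub_subcell_le {q : Fin d → Fin d → ℝ} (hq : ∀ j k, q j k = q k j) {ε o : ℝ}
    (hε₀ : 0 ≤ ε) (hε : ∀ j k, j ≠ k → |edgeLaplacian q j k| ≤ ε)
    (ho : ∀ j k, |q j j - q k k| ≤ o) (i j k : Fin d) :
    |q i j - q i k| ≤ d / (d + 2) * o + ε := by
  have ho₀ : 0 ≤ o := (abs_nonneg _).trans (ho i i)
  set p : Fin d → ℝ := fun l => q l l
  have near_corner {k : Fin d} (hik : i ≠ k) : |q i i - q i k| ≤ d / (d + 2) * o + ε := by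
    have hmid := abs_sub_harmonicValue_le hq hε hik
    rw [abs_sub_comm] at hmid
    linarith [abs_sub_le (q i i) (harmonicValue p i k) (q i k),
      abs_apply_sub_harmonicValue_le (p := p) (ho i) k]
  rcases eq_or_ne j k with rfl | hjk
  · rw [sub_self, abs_zero]
    positivity
  rcases eq_or_ne i j with rfl | hij
  · exact near_corner hjk
  rcases eq_or_ne i k with rfl | hik
  · rw [abs_sub_comm]
    exact near_corner hij
  · have hmid := abs_sub_harmonicValue_le hq hε hik
    rw [abs_sub_comm] at hmid
    linarith [abs_sub_le (q i j) (harmonicValue p i j) (q i k),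
      abs_sub_le (harmonicValue p i j) (harmonicValue p i k) (q i k),
      abs_sub_harmonicValue_le hq hε hij, abs_harmonicValue_sub_le (p := p) i (ho j k)]

end Spline

section NormLaplacian

/-- The graph Laplacian with the normalization under which it converges to the Laplacian. -/
def normLaplacian (P : Fin d → Space d) (m : ℕ) (f : Space d → ℝ) (X : Space d) : ℝ :=
  normalization d m * graphLaplacian P m f X

theorem normalization_nonneg (d m : ℕ) : 0 ≤ normalization d m := by
  unfold normalization
  positivity

theorem normalization_succ (d m : ℕ) :
    normalization d (m + 1) = (d + 2) * normalization d m := by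
  unfold normalization
  ring

theorem graphLaplacian_const_mul (P : Fin d → Space d) (m : ℕ) (c : ℝ) (f : Space d → ℝ)
    (X : Space d) : graphLaplacian P m (fun Y => c * f Y) X = c * graphLaplacian P m f X := by
  simp only [graphLaplacian, Finset.mul_sum, mul_sub]

theorem graphLaplacian_sub (P : Fin d → Space d) (m : ℕ) (f g : Space d → ℝ) (X : Space d) :
    graphLaplacian P m (fun Y => f Y - g Y) X =
      graphLaplacian P m f X - graphLaplacian P m g X := by
  simp only [graphLaplacian, ← Finset.sum_sub_distrib, sub_sub_sub_comm]

theorem normLaplacian_neg (P : Fin d → Space d) (m : ℕ) (f : Space d → ℝ) (X : Space d) :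
    normLaplacian P m (fun Y => -f Y) X = -normLaplacian P m f X := by
  simpa only [normLaplacian, neg_one_mul, mul_neg] using
    congrArg (normalization d m * ·) (graphLaplacian_const_mul P m (-1) f X)

theorem graphLaplacian_edgeMidpoint (hP : AffineIndependent ℝ P) (f : Space d → ℝ)
    (w : List (Fin d)) {j k : Fin d} (hjk : j ≠ k) :
    graphLaplacian P (w.length + 1) f (edgeMidpoint P w j k) =
      edgeLaplacian (fun j k => f (edgeMidpoint P w j k)) j k := by
  have hjk_mem := concat_mem_addresses_edgeMidpoint P w j k
  have hkj_mem := concat_mem_addresses_edgeMidpoint P w k j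
  rw [edgeMidpoint_comm] at hkj_mem
  rw [graphLaplacian_eq_add_cornerSum hP
    (mem_interiorVertices.1 (edgeMidpoint_mem_interiorVertices hP w hjk)).2 hjk_mem hkj_mem
    (fun h => hjk (List.singleton_injective (List.append_cancel_left h)))]
  simp only [cornerSum, wordMap_concat_apply, edgeLaplacian, edgeMidpoint_comm P w k j]

theorem mul_cornerSum_eq (hP : AffineIndependent ℝ P) (f : Space d → ℝ) (w : List (Fin d))
    (i : Fin d) :
    d * cornerSum P f w i = (d + 2) * cornerSum P f (w ++ [i]) i + 2⁻¹ * splineSum i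
      fun j k => graphLaplacian P (w.length + 1) f (edgeMidpoint P w j k) := by
  rw [splineSum_congr i fun j k => graphLaplacian_edgeMidpoint hP f w]
  have h := mul_sum_sub_eq_splineSum (q := fun j k => f (edgeMidpoint P w j k))
    (fun j k => by rw [edgeMidpoint_comm]) i
  simpa only [cornerSum, wordMap_concat_apply, edgeMidpoint_self] using h

theorem mul_normLaplacian_eq (hP : AffineIndependent ℝ P) (f : Space d → ℝ) {m : ℕ} {X : Space d}
    (hX : X ∉ vertices P 0) {w w' : List (Fin d)} {i i' : Fin d} (hw : (w, i) ∈ addresses P m X)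
    (hw' : (w', i') ∈ addresses P m X) (hne : w ≠ w') :
    d * (d + 2) * normLaplacian P m f X = (d + 2) * normLaplacian P (m + 1) f X +
      2⁻¹ * (splineSum i (fun j k => normLaplacian P (m + 1) f (edgeMidpoint P w j k)) +
        splineSum i' fun j k => normLaplacian P (m + 1) f (edgeMidpoint P w' j k)) := by
  have hcorner := mul_cornerSum_eq hP f w i
  have hcorner' := mul_cornerSum_eq hP f w' i'
  rw [hw.1] at hcorner
  rw [hw'.1] at hcorner'
  simp only [normLaplacian, splineSum_const_mul, normalization_succ]
  rw [graphLaplacian_eq_add_cornerSum hP hX hw hw' hne,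
    graphLaplacian_eq_add_cornerSum hP hX (concat_mem_addresses_succ hw)
      (concat_mem_addresses_succ hw') fun h => hne (List.append_inj_left' h rfl)]
  linear_combination ((d : ℝ) + 2) * normalization d m * (hcorner + hcorner')

theorem exists_normLaplacian_le (hP : AffineIndependent ℝ P) (f : Space d → ℝ) {m : ℕ}
    {X : Space d} (hX : X ∈ interiorVertices P m) :
    ∃ w i j k, (w, i) ∈ addresses P m X ∧ edgeMidpoint P w j k ∈ interiorVertices P (m + 1) ∧
      normLaplacian P m f X ≤ normLaplacian P (m + 1) f (edgeMidpoint P w j k) := by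
  obtain ⟨hXm, hX₀⟩ := mem_interiorVertices.1 hX
  obtain ⟨w, i, w', i', hne, hpair⟩ := exists_addresses_eq hP hX
  have hw : (w, i) ∈ addresses P m X := hpair ▸ Set.mem_insert _ _
  have hw' : (w', i') ∈ addresses P m X := hpair ▸ Set.mem_insert_of_mem _ rfl
  by_contra! hlt
  have hself : normLaplacian P (m + 1) f X < normLaplacian P m f X := by
    have h := hlt w i i i hw
    rw [edgeMidpoint_self, hw.2] at h
    exact h (mem_interiorVertices.2 ⟨vertices_subset_succ P m hXm, hX₀⟩)
  have splineSum_le {v : List (Fin d)} {l : Fin d} (hv : (v, l) ∈ addresses P m X) :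
      splineSum l (fun j k => normLaplacian P (m + 1) f (edgeMidpoint P v j k)) ≤
        ((d : ℝ) - 1) * (d + 2) * normLaplacian P m f X := by
    rw [← splineSum_const l]
    exact splineSum_mono l fun j k hjk =>
      (hlt v l j k hv (hv.1 ▸ edgeMidpoint_mem_interiorVertices hP v hjk)).le
  have hlt_mul : ((d : ℝ) + 2) * normLaplacian P (m + 1) f X < (d + 2) * normLaplacian P m f X :=
    mul_lt_mul_of_pos_left hself (by positivity)
  linarith [mul_normLaplacian_eq hP f hX₀ hw hw' hne, splineSum_le hw, splineSum_le hw']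

end NormLaplacian

section RefiningSequences

variable {f F : Space d → ℝ}

theorem HasLaplacian.const_mul (c : ℝ) (hf : HasLaplacian P f F) :
    HasLaplacian P (fun X => c * f X) (fun X => c * F X) where
  continuousOn := continuousOn_const.mul hf.continuousOn
  continuousOn_laplacian := continuousOn_const.mul hf.continuousOn_laplacian
  tendsto X hX x hx hxX := by
    simpa only [graphLaplacian_const_mul, mul_left_comm] using
      (hf.tendsto X hX x hx hxX).const_mul c

theorem HasLaplacian.neg (hf : HasLaplacian P f F) :
    HasLaplacian P (fun X => -f X) (fun X => -F X) := by
  simpa only [neg_one_mul] using hf.const_mul (-1)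

theorem HasLaplacian.sub {g G : Space d → ℝ} (hf : HasLaplacian P f F)
    (hg : HasLaplacian P g G) : HasLaplacian P (fun X => f X - g X) (fun X => F X - G X) where
  continuousOn := hf.continuousOn.sub hg.continuousOn
  continuousOn_laplacian := hf.continuousOn_laplacian.sub hg.continuousOn_laplacian
  tendsto X hX x hx hxX := by
    simpa only [graphLaplacian_sub, mul_sub] using
      (hf.tendsto X hX x hx hxX).sub (hg.tendsto X hX x hx hxX)

theorem HasLaplacian.tendsto_normLaplacian (hP : AffineIndependent ℝ P) (hf : HasLaplacian P f F)
    {m : ℕ} {x : ℕ → Space d} (hx : ∀ n, x n ∈ interiorVertices P (m + n)) {X : Space d}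
    (hX : X ∈ simplex P) (hxX : Tendsto x atTop (𝓝 X)) :
    Tendsto (fun n => normLaplacian P (m + n) f (x n)) atTop (𝓝 (F X)) := by
  choose! z hz using fun (n : ℕ) (hn : 1 ≤ n) =>
    interiorVertices_nonempty (two_le_of_mem_interiorVertices (hx 0)) hP hn
  let y : ℕ → Space d := fun n => if n < m then z n else x (n - m)
  have hyx (n : ℕ) : y (n + m) = x n := by simp [y]
  have hy (n : ℕ) (hn : 1 ≤ n) : y n ∈ interiorVertices P n := by
    rcases lt_or_ge n m with hnm | hmn
    · simpa only [y, if_pos hnm] using hz n hn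
    · obtain ⟨l, rfl⟩ := Nat.exists_eq_add_of_le' hmn
      rw [hyx, add_comm]
      exact hx l
  have hyX : Tendsto y atTop (𝓝 X) := by
    rw [← tendsto_add_atTop_iff_nat m]
    simpa only [hyx] using hxX
  refine ((tendsto_add_atTop_iff_nat m).2 (hf.tendsto X hX y hy hyX)).congr fun n => ?_
  rw [hyx, add_comm n m, normLaplacian]

/-- A sequence of interior vertices whose levels are `m`, `m + 1`, …, in which the successor of a
vertex is a vertex or the midpoint of an edge of a cell that contains it. -/
structure IsRefiningSeq (P : Fin d → Space d) (m : ℕ) (x : ℕ → Space d) : Prop where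
  mem_interiorVertices : ∀ n, x n ∈ interiorVertices P (m + n)
  exists_edgeMidpoint_eq : ∀ n, ∃ w i j k,
    (w, i) ∈ addresses P (m + n) (x n) ∧ edgeMidpoint P w j k = x (n + 1)

namespace IsRefiningSeq

variable {m : ℕ} {x : ℕ → Space d}

theorem mem_simplex (hx : IsRefiningSeq P m x) (n : ℕ) : x n ∈ simplex P :=
  mem_simplex_of_mem_interiorVertices (hx.mem_interiorVertices n)

theorem dist_succ_le (hx : IsRefiningSeq P m x) (n : ℕ) :
    dist (x n) (x (n + 1)) ≤ 2 * Metric.diam (simplex P) / 2 ^ m / 2 / 2 ^ n := by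
  obtain ⟨w, i, j, k, ⟨hwm, hi⟩, hjk⟩ := hx.exists_edgeMidpoint_eq n
  have h := dist_wordMap_le (apply_mem_simplex P i)
    (contraction_mem_simplex (apply_mem_simplex P k) j) w
  rw [hwm] at h
  rw [← hi, ← hjk]
  refine h.trans_eq ?_
  rw [pow_add]
  field_simp

theorem exists_tendsto (hx : IsRefiningSeq P m x) : ∃ X ∈ simplex P, Tendsto x atTop (𝓝 X) := by
  obtain ⟨X, hX⟩ := cauchySeq_tendsto_of_complete (cauchySeq_of_le_geometric_two hx.dist_succ_le)
  exact ⟨X, isClosed_closure.mem_of_tendsto hX (Eventually.of_forall hx.mem_simplex), hX⟩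

theorem dist_le_of_tendsto (hx : IsRefiningSeq P m x) {X : Space d}
    (hX : Tendsto x atTop (𝓝 X)) : dist (x 0) X ≤ 2 * Metric.diam (simplex P) / 2 ^ m :=
  dist_le_of_le_geometric_two_of_tendsto₀ hx.dist_succ_le hX

end IsRefiningSeq

theorem exists_isRefiningSeq_monotone (hP : AffineIndependent ℝ P) (f : Space d → ℝ) {m : ℕ}
    {X : Space d} (hX : X ∈ interiorVertices P m) :
    ∃ x, IsRefiningSeq P m x ∧ x 0 = X ∧ Monotone fun n => normLaplacian P (m + n) f (x n) := by
  have : Nonempty (Fin d) := ⟨⟨0, by have := two_le_of_mem_interiorVertices hX; lia⟩⟩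
  choose! w i j k hw hmem hle using fun (n : ℕ) (Y : Space d) (hY : Y ∈ interiorVertices P n) =>
    exists_normLaplacian_le hP f hY
  let x : ℕ → Space d := fun n => Nat.rec X
    (fun n Y => edgeMidpoint P (w (m + n) Y) (j (m + n) Y) (k (m + n) Y)) n
  have hx (n : ℕ) : x n ∈ interiorVertices P (m + n) := by
    induction n with
    | zero => exact hX
    | succ n ih => exact hmem _ _ ih
  exact ⟨x, ⟨hx, fun n => ⟨_, _, _, _, hw _ _ (hx n), rfl⟩⟩, rfl,
    monotone_nat_of_le_succ fun n => hle _ _ (hx n)⟩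

theorem HasLaplacian.exists_isRefiningSeq (hP : AffineIndependent ℝ P) (hf : HasLaplacian P f F)
    {m : ℕ} {X : Space d} (hX : X ∈ interiorVertices P m) :
    ∃ x, IsRefiningSeq P m x ∧ x 0 = X ∧
      ∃ Y ∈ simplex P, Tendsto x atTop (𝓝 Y) ∧ normLaplacian P m f X ≤ F Y := by
  obtain ⟨x, hx, rfl, hmono⟩ := exists_isRefiningSeq_monotone hP f hX
  obtain ⟨Y, hY, hxY⟩ := hx.exists_tendsto
  exact ⟨x, hx, rfl, Y, hY, hxY,
    hmono.ge_of_tendsto (hf.tendsto_normLaplacian hP hx.mem_interiorVertices hY hxY) 0⟩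

theorem HasLaplacian.abs_normLaplacian_le (hP : AffineIndependent ℝ P) (hf : HasLaplacian P f F)
    {M : ℝ} (hM : ∀ X ∈ simplex P, |F X| ≤ M) {m : ℕ} {X : Space d}
    (hX : X ∈ interiorVertices P m) : |normLaplacian P m f X| ≤ M := by
  obtain ⟨-, -, -, Y, hY, -, hle⟩ := hf.exists_isRefiningSeq hP hX
  obtain ⟨-, -, -, Z, hZ, -, hle_neg⟩ := hf.neg.exists_isRefiningSeq hP hX
  rw [normLaplacian_neg] at hle_neg
  exact abs_le'.2 ⟨hle.trans ((le_abs_self _).trans (hM Y hY)),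
    hle_neg.trans ((neg_le_abs _).trans (hM Z hZ))⟩

end RefiningSequences

section ResistanceLipschitz

variable {f F : Space d → ℝ}

/-- On the vertices of a cell of order `m`, `f` oscillates at most by `B * (d / (d + 2)) ^ m`.
Up to a factor, `(d / (d + 2)) ^ m` is the diameter of the cell in the resistance metric. -/
def IsResistanceLipschitz (P : Fin d → Space d) (B : ℝ) (f : Space d → ℝ) : Prop :=
  ∀ (w : List (Fin d)) (i j : Fin d),
    |f (wordMap P w (P i)) - f (wordMap P w (P j))| ≤ B * ((d : ℝ) / (d + 2)) ^ w.length

theorem IsResistanceLipschitz.neg {B : ℝ} (hf : IsResistanceLipschitz P B f) :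
    IsResistanceLipschitz P B fun X => -f X := fun w i j => by
  rw [neg_sub_neg]
  exact hf w j i

theorem HasLaplacian.abs_edgeLaplacian_le (hP : AffineIndependent ℝ P) (hf : HasLaplacian P f F)
    {M : ℝ} (hM : ∀ X ∈ simplex P, |F X| ≤ M) (w : List (Fin d)) {j k : Fin d} (hjk : j ≠ k) :
    |edgeLaplacian (fun j k => f (edgeMidpoint P w j k)) j k| ≤
      M / normalization d (w.length + 1) := by
  have hd : (0 : ℝ) < d := by exact_mod_cast j.pos
  have hc : 0 < normalization d (w.length + 1) := by unfold normalization; positivity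
  rw [← graphLaplacian_edgeMidpoint hP f w hjk, le_div_iff₀' hc, ← abs_of_pos hc, ← abs_mul]
  exact hf.abs_normLaplacian_le hP hM (edgeMidpoint_mem_interiorVertices hP w hjk)

theorem inv_normalization_le (hd : 2 ≤ d) (m : ℕ) :
    (normalization d m)⁻¹ ≤ ((d : ℝ) - 1) * (1 / (d + 2)) ^ m := by
  have hd' : (2 : ℝ) ≤ d := by exact_mod_cast hd
  rw [normalization, mul_inv, ← inv_pow, ← one_div ((d : ℝ) + 2)]
  gcongr
  rw [inv_div, div_le_iff₀ (by positivity)]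
  nlinarith

theorem HasLaplacian.abs_sub_le (hP : AffineIndependent ℝ P) (hf : HasLaplacian P f F)
    (hf₀ : ∀ X ∈ vertices P 0, f X = 0) {M : ℝ} (hM : ∀ X ∈ simplex P, |F X| ≤ M)
    (w : List (Fin d)) (i j : Fin d) :
    |f (wordMap P w (P i)) - f (wordMap P w (P j))| ≤
      M * (((d : ℝ) / (d + 2)) ^ w.length - (1 / (d + 2)) ^ w.length) := by
  have hM₀ : 0 ≤ M := (abs_nonneg _).trans (hM _ (apply_mem_simplex P i))
  have hd : (1 : ℝ) ≤ d := by exact_mod_cast i.pos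
  induction w using List.reverseRecOn generalizing i j with
  | nil => simp [wordMap, hf₀ _ (mem_vertices_zero P _)]
  | append_singleton w a ih =>
    rcases eq_or_ne i j with rfl | hij
    · rw [sub_self, abs_zero, sub_eq_add_neg]
      refine mul_nonneg hM₀ (sub_nonneg.2 ?_)
      gcongr
    have hd₂ : 2 ≤ d := by have := i.isLt; have := j.isLt; have := Fin.val_ne_of_ne hij; lia
    have hsub := abs_sub_subcell_le (fun j k => by rw [edgeMidpoint_comm])
      (div_nonneg hM₀ (normalization_nonneg d _))
      (fun j k => hf.abs_edgeLaplacian_le hP hM w)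
      (fun j k => by simpa only [edgeMidpoint_self] using ih j k) a i j
    rw [wordMap_concat_apply, wordMap_concat_apply]
    calc
      _ ≤ d / (d + 2) * (M * (((d : ℝ) / (d + 2)) ^ w.length - (1 / (d + 2)) ^ w.length)) +
          M * ((d - 1) * (1 / (d + 2)) ^ (w.length + 1)) := by
        refine hsub.trans ?_
        rw [div_eq_mul_inv M]
        gcongr
        exact inv_normalization_le hd₂ _
      _ = _ := by
        rw [List.length_append, List.length_singleton, pow_succ, pow_succ]
        field_simp
        ring

theorem HasLaplacian.isResistanceLipschitz (hP : AffineIndependent ℝ P) (hf : HasLaplacian P f F)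
    (hf₀ : ∀ X ∈ vertices P 0, f X = 0) {M : ℝ} (hM : ∀ X ∈ simplex P, |F X| ≤ M) :
    IsResistanceLipschitz P M f := by
  intro w i j
  have hM₀ : 0 ≤ M := (abs_nonneg _).trans (hM _ (apply_mem_simplex P i))
  refine (hf.abs_sub_le hP hf₀ hM w i j).trans ?_
  gcongr
  exact sub_le_self _ (by positivity)

theorem IsResistanceLipschitz.nonneg {B : ℝ} (hd : 0 < d) (hf : IsResistanceLipschitz P B f) :
    0 ≤ B := by
  simpa using (abs_nonneg _).trans (hf [] ⟨0, hd⟩ ⟨0, hd⟩)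

theorem IsResistanceLipschitz.dist_edgeMidpoint_le {B : ℝ} (hf : IsResistanceLipschitz P B f)
    (w : List (Fin d)) (i j k : Fin d) :
    dist (f (wordMap P w (P i))) (f (edgeMidpoint P w j k)) ≤
      2 * B * ((d : ℝ) / (d + 2)) ^ w.length := by
  have hB := hf.nonneg i.pos
  have hr : (d : ℝ) / (d + 2) ≤ 1 := div_le_one_of_le₀ (by linarith) (by positivity)
  have hsub := hf (w ++ [j]) j k
  rw [wordMap_concat_apply, wordMap_concat_apply, edgeMidpoint_self, List.length_append,
    List.length_singleton] at hsub
  have hpow : B * ((d : ℝ) / (d + 2)) ^ (w.length + 1) ≤ B * ((d : ℝ) / (d + 2)) ^ w.length :=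
    mul_le_mul_of_nonneg_left (pow_le_pow_of_le_one (by positivity) hr (Nat.le_succ _)) hB
  rw [Real.dist_eq]
  linarith [hf w i j, abs_sub_le (f (wordMap P w (P i))) (f (wordMap P w (P j)))
    (f (edgeMidpoint P w j k))]

theorem IsRefiningSeq.dist_apply_le {m : ℕ} {x : ℕ → Space d} (hx : IsRefiningSeq P m x) {B : ℝ}
    (hF : IsResistanceLipschitz P B F) (hFc : ContinuousOn F (simplex P)) {Y : Space d}
    (hY : Y ∈ simplex P) (hxY : Tendsto x atTop (𝓝 Y)) :
    dist (F (x 0)) (F Y) ≤ (d + 2) * B * ((d : ℝ) / (d + 2)) ^ m := by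
  have hr : (d : ℝ) / (d + 2) < 1 := (div_lt_one (by positivity)).2 (by linarith)
  have hlim : Tendsto (fun n => F (x n)) atTop (𝓝 (F Y)) :=
    (hFc Y hY).tendsto.comp (tendsto_nhdsWithin_iff.2 ⟨hxY, .of_forall hx.mem_simplex⟩)
  have hstep (n : ℕ) : dist (F (x n)) (F (x (n + 1))) ≤
      2 * B * ((d : ℝ) / (d + 2)) ^ m * ((d : ℝ) / (d + 2)) ^ n := by
    obtain ⟨w, i, j, k, ⟨hw, hi⟩, hjk⟩ := hx.exists_edgeMidpoint_eq n
    rw [← hi, ← hjk, mul_assoc, ← pow_add, ← hw]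
    exact hF.dist_edgeMidpoint_le w i j k
  refine (dist_le_of_le_geometric_of_tendsto₀ _ _ hr hstep hlim).trans_eq ?_
  have hone_sub : (1 : ℝ) - d / (d + 2) = 2 / (d + 2) := by field_simp; ring
  rw [hone_sub]
  field_simp

theorem HasLaplacian.abs_normLaplacian_sub_le (hP : AffineIndependent ℝ P)
    (hf : HasLaplacian P f F) {B : ℝ} (hF : IsResistanceLipschitz P B F) {m : ℕ} {X : Space d}
    (hX : X ∈ interiorVertices P m) :
    |normLaplacian P m f X - F X| ≤ (d + 2) * B * ((d : ℝ) / (d + 2)) ^ m := by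
  have sub_le {f F : Space d → ℝ} (hf : HasLaplacian P f F) (hF : IsResistanceLipschitz P B F) :
      normLaplacian P m f X - F X ≤ (d + 2) * B * ((d : ℝ) / (d + 2)) ^ m := by
    obtain ⟨x, hx, rfl, Y, hY, hxY, hle⟩ := hf.exists_isRefiningSeq hP hX
    have hdist := hx.dist_apply_le hF hf.continuousOn_laplacian hY hxY
    rw [dist_comm, Real.dist_eq] at hdist
    linarith [le_abs_self (F Y - F (x 0))]
  have hneg := sub_le hf.neg hF.neg
  rw [normLaplacian_neg] at hneg
  exact abs_le'.2 ⟨sub_le hf hF, by linarith⟩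

end ResistanceLipschitz

section Holder

variable {f F : Space d → ℝ} {α : ℝ}

theorem IsHolder.neg (hf : IsHolder P α f) : IsHolder P α fun X => -f X := by
  obtain ⟨C, hC⟩ := hf
  refine ⟨C, fun X hX Y hY => ?_⟩
  rw [neg_sub_neg, abs_sub_comm]
  exact hC X hX Y hY

theorem IsHolder.exists_abs_cornerSum_le (hf : IsHolder P α f) (w : List (Fin d)) (i : Fin d) :
    ∃ K, ∀ n, |cornerSum P f (w ++ List.replicate n i) i| ≤ K * ((2⁻¹ : ℝ) ^ α) ^ n := by
  obtain ⟨C, hC⟩ := hf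
  refine ⟨∑ k, C * (((2⁻¹ : ℝ) ^ α) ^ w.length * dist (P k) (P i) ^ α), fun n => ?_⟩
  refine (Finset.abs_sum_le_sum_abs _ _).trans ?_
  rw [Finset.sum_mul]
  refine Finset.sum_le_sum fun k _ => ?_
  refine (hC _ (wordMap_mem_simplex (apply_mem_simplex P k) _) _
    (wordMap_mem_simplex (apply_mem_simplex P i) _)).trans_eq ?_
  rw [← dist_eq_norm, dist_wordMap, Real.mul_rpow (by positivity) dist_nonneg,
    ← Real.rpow_pow_comm (by norm_num), List.length_append, List.length_replicate, pow_add]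
  ring

/-- `f` has nonnegative graph Laplacian at all edge midpoints in the cell of the word `w`, each
taken at the level at which it first occurs. -/
def IsSubharmonicOnCell (P : Fin d → Space d) (f : Space d → ℝ) (w : List (Fin d)) : Prop :=
  ∀ (u : List (Fin d)) (j k : Fin d), j ≠ k →
    0 ≤ graphLaplacian P ((w ++ u).length + 1) f (edgeMidpoint P (w ++ u) j k)

theorem IsSubharmonicOnCell.append {w : List (Fin d)} (h : IsSubharmonicOnCell P f w)
    (v : List (Fin d)) : IsSubharmonicOnCell P f (w ++ v) := fun u j k hjk => by
  rw [List.append_assoc]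
  exact h (v ++ u) j k hjk

theorem IsSubharmonicOnCell.mul_cornerSum_concat_le (hP : AffineIndependent ℝ P)
    {w : List (Fin d)} (h : IsSubharmonicOnCell P f w) (i : Fin d) :
    (d + 2) * cornerSum P f (w ++ [i]) i ≤ d * cornerSum P f w i := by
  have hspline := splineSum_mono i fun j k hjk => h [] j k hjk
  rw [splineSum_const, mul_zero, List.append_nil] at hspline
  linarith [mul_cornerSum_eq hP f w i]

-- The corner sums decay like `2 ^ (-n * α)`, but subharmonicity allows a negative one to decay at
-- most like `(d / (d + 2)) ^ n`.
theorem IsSubharmonicOnCell.cornerSum_nonneg (hP : AffineIndependent ℝ P) (hf : IsHolder P α f)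
    (hα : (2⁻¹ : ℝ) ^ α < d / (d + 2)) {w : List (Fin d)} (h : IsSubharmonicOnCell P f w)
    (i : Fin d) : 0 ≤ cornerSum P f w i := by
  have hd : (0 : ℝ) < d := by exact_mod_cast i.pos
  set a : ℕ → ℝ := fun n => cornerSum P f (w ++ List.replicate n i) i
  have hanti : Antitone fun n => a n * (((d : ℝ) + 2) / d) ^ n := by
    refine antitone_nat_of_succ_le fun n => ?_
    rw [pow_succ', ← mul_assoc]
    refine mul_le_mul_of_nonneg_right ?_ (by positivity)
    have hstep := (h.append (List.replicate n i)).mul_cornerSum_concat_le hP i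
    rw [List.append_assoc, ← List.replicate_succ'] at hstep
    rw [← mul_div_assoc, div_le_iff₀ hd]
    linarith
  have hlim : Tendsto (fun n => a n * (((d : ℝ) + 2) / d) ^ n) atTop (𝓝 0) := by
    obtain ⟨K, hK⟩ := hf.exists_abs_cornerSum_le w i
    have hratio : (2⁻¹ : ℝ) ^ α * ((d + 2) / d) < 1 := by
      rwa [← mul_div_assoc, div_lt_one hd, ← lt_div_iff₀ (by positivity)]
    have hgeom := (tendsto_pow_atTop_nhds_zero_of_lt_one (by positivity) hratio).const_mul K
    rw [mul_zero] at hgeom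
    refine squeeze_zero_norm (fun n => ?_) hgeom
    rw [Real.norm_eq_abs, abs_mul, abs_of_nonneg (by positivity : 0 ≤ (((d : ℝ) + 2) / d) ^ n),
      mul_pow, ← mul_assoc]
    exact mul_le_mul_of_nonneg_right (hK n) (by positivity)
  simpa [a] using hanti.le_of_tendsto hlim 0

theorem IsSubharmonicOnCell.cornerSum_eq_zero (hP : AffineIndependent ℝ P) (hf : IsHolder P α f)
    (hα : (2⁻¹ : ℝ) ^ α < d / (d + 2)) {w : List (Fin d)} (h : IsSubharmonicOnCell P f w)
    (i : Fin d) : cornerSum P f w i = 0 :=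
  (Finset.sum_eq_zero_iff_of_nonneg fun i _ => h.cornerSum_nonneg hP hf hα i).1
    (sum_cornerSum P f w) i (Finset.mem_univ i)

theorem IsSubharmonicOnCell.graphLaplacian_edgeMidpoint_eq_zero (hP : AffineIndependent ℝ P)
    (hf : IsHolder P α f) (hα : (2⁻¹ : ℝ) ^ α < d / (d + 2)) {w : List (Fin d)}
    (h : IsSubharmonicOnCell P f w) {j k : Fin d} (hjk : j ≠ k) :
    graphLaplacian P (w.length + 1) f (edgeMidpoint P w j k) = 0 := by
  have hj := (h.append [j]).cornerSum_eq_zero hP hf hα k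
  have hk := (h.append [k]).cornerSum_eq_zero hP hf hα j
  simp only [cornerSum, wordMap_concat_apply, edgeMidpoint_comm P w k j] at hj hk
  rw [graphLaplacian_edgeMidpoint hP f w hjk, edgeLaplacian, hj, hk, add_zero]

theorem HasLaplacian.exists_graphLaplacian_pos (hP : AffineIndependent ℝ P)
    (hf : HasLaplacian P f F) {X : Space d} (hX : X ∈ simplex P) (hpos : 0 < F X) :
    ∃ w : List (Fin d), ∀ (u : List (Fin d)) (j k : Fin d), j ≠ k →
      0 < graphLaplacian P ((w ++ u).length + 1) f (edgeMidpoint P (w ++ u) j k) := by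
  obtain ⟨δ, hδ, hball⟩ := Metric.mem_nhdsWithin_iff.1
    ((hf.continuousOn_laplacian X hX).eventually (lt_mem_nhds hpos))
  obtain ⟨n, hn⟩ :=
    pow_unbounded_of_one_lt (3 * Metric.diam (simplex P) / δ) (one_lt_two : (1 : ℝ) < 2)
  rw [div_lt_comm₀ hδ (by positivity)] at hn
  obtain ⟨w, rfl, Y, hY, rfl⟩ := exists_mem_wordMap_image_simplex hX n
  refine ⟨w, fun u j k hjk => ?_⟩
  obtain ⟨x, hx, hx₀, Z, hZ, hxZ, hle⟩ := hf.neg.exists_isRefiningSeq hP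
    (edgeMidpoint_mem_interiorVertices hP (w ++ u) hjk)
  have hmid : dist (wordMap P w Y) (x 0) ≤ Metric.diam (simplex P) / 2 ^ w.length := by
    rw [hx₀, edgeMidpoint, wordMap_append]
    exact dist_wordMap_le hY
      (wordMap_mem_simplex (contraction_mem_simplex (apply_mem_simplex P k) j) u) w
  have hlim : dist (x 0) Z ≤ 2 * Metric.diam (simplex P) / 2 ^ w.length := by
    refine (hx.dist_le_of_tendsto hxZ).trans ?_
    rw [List.length_append, add_assoc]
    gcongr
    exacts [one_le_two, Nat.le_add_right _ _]
  have hFZ : 0 < F Z := by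
    refine hball ⟨?_, hZ⟩
    rw [Metric.mem_ball, dist_comm]
    refine ((dist_triangle _ _ _).trans (add_le_add hmid hlim)).trans_lt ?_
    convert hn using 1
    ring
  rw [normLaplacian_neg] at hle
  exact pos_of_mul_pos_right (hFZ.trans_le (neg_le_neg_iff.1 hle)) (normalization_nonneg d _)

theorem HasLaplacian.nonpos_of_isHolder (hd : 2 ≤ d) (hP : AffineIndependent ℝ P)
    (hf : HasLaplacian P f F) (hholder : IsHolder P α f) (hα : (2⁻¹ : ℝ) ^ α < d / (d + 2))
    {X : Space d} (hX : X ∈ simplex P) : F X ≤ 0 := by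
  by_contra! hpos
  obtain ⟨w, hw⟩ := hf.exists_graphLaplacian_pos hP hX hpos
  have hsub : IsSubharmonicOnCell P f w := fun u j k hjk => (hw u j k hjk).le
  have hne : (⟨0, by lia⟩ : Fin d) ≠ ⟨1, hd⟩ := by simp
  have hedge := hw [] _ _ hne
  rw [List.append_nil] at hedge
  exact hedge.ne' (hsub.graphLaplacian_edgeMidpoint_eq_zero hP hholder hα hne)

theorem HasLaplacian.eq_zero_of_isHolder (hd : 2 ≤ d) (hP : AffineIndependent ℝ P)
    (hf : HasLaplacian P f F) (hholder : IsHolder P α f) (hα : (2⁻¹ : ℝ) ^ α < d / (d + 2))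
    {X : Space d} (hX : X ∈ simplex P) : F X = 0 :=
  (hf.nonpos_of_isHolder hd hP hholder hα hX).antisymm
    (neg_nonpos.1 (hf.neg.nonpos_of_isHolder hd hP hholder.neg hα hX))

theorem HasLaplacian.eq_zero_of_laplacian_eq_zero (hP : AffineIndependent ℝ P)
    (hf : HasLaplacian P f F) (hf₀ : ∀ X ∈ vertices P 0, f X = 0)
    (hF : ∀ X ∈ simplex P, F X = 0) {m : ℕ} {X : Space d} (hX : X ∈ vertices P m) : f X = 0 := by
  obtain ⟨w, i, -, rfl⟩ := mem_vertices_iff.1 hX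
  clear hX
  induction w using List.reverseRecOn generalizing i with
  | nil => exact hf₀ _ (mem_vertices_zero P i)
  | append_singleton w a ih =>
    have hosc := hf.isResistanceLipschitz hP hf₀ (M := 0) (fun X hX => by simp [hF X hX])
      (w ++ [a]) i a
    rwa [zero_mul, abs_nonpos_iff, wordMap_concat_apply P w a a, edgeMidpoint_self, ih a,
      sub_zero] at hosc

end Holder

section MaximumPrinciple

variable {m N : ℕ} {h B : ℝ} {f : Space d → ℝ}

theorem le_of_sub_normLaplacian_le (hh : 0 ≤ h) (hB : 0 ≤ B) (hf₀ : ∀ X ∈ vertices P 0, f X = 0)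
    (hf : ∀ X ∈ interiorVertices P m, f X - h * normLaplacian P m f X ≤ B) {X : Space d}
    (hX : X ∈ vertices P m) : f X ≤ B := by
  classical
  obtain ⟨Z, hZ, hmax⟩ := (vertices P m).exists_max_image f ⟨X, hX⟩
  refine (hmax X hX).trans ?_
  by_cases hZ₀ : Z ∈ vertices P 0
  · rwa [hf₀ Z hZ₀]
  · have hgraph : graphLaplacian P m f Z ≤ 0 := Finset.sum_nonpos fun Y hY =>
      sub_nonpos.2 (hmax Y (Finset.mem_filter.1 hY).1)
    have hnorm : h * normLaplacian P m f Z ≤ 0 := mul_nonpos_of_nonneg_of_nonpos hh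
      (mul_nonpos_of_nonneg_of_nonpos (normalization_nonneg d m) hgraph)
    linarith [hf Z (mem_interiorVertices.2 ⟨hZ, hZ₀⟩)]

theorem abs_le_of_abs_sub_normLaplacian_le (hh : 0 ≤ h) (hB : 0 ≤ B)
    (hf₀ : ∀ X ∈ vertices P 0, f X = 0)
    (hf : ∀ X ∈ interiorVertices P m, |f X - h * normLaplacian P m f X| ≤ B) {X : Space d}
    (hX : X ∈ vertices P m) : |f X| ≤ B := by
  refine abs_le'.2 ⟨le_of_sub_normLaplacian_le hh hB hf₀
    (fun Y hY => (le_abs_self _).trans (hf Y hY)) hX, ?_⟩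
  refine le_of_sub_normLaplacian_le (f := fun X => -f X) hh hB
    (fun Y hY => by rw [hf₀ Y hY, neg_zero]) (fun Y hY => ?_) hX
  rw [normLaplacian_neg]
  linarith [(abs_le.1 (hf Y hY)).1]

theorem abs_le_of_abs_residual_le {τ : ℝ} (hh : 0 < h) (hτ : 0 ≤ τ) {e : ℕ → Space d → ℝ}
    (he_boundary : ∀ k ≤ N, ∀ X ∈ vertices P 0, e k X = 0)
    (he_initial : ∀ X ∈ interiorVertices P m, e 0 X = 0)
    (he_step : ∀ k < N, ∀ X ∈ interiorVertices P m,
      |(e (k + 1) X - e k X) / h - normLaplacian P m (e (k + 1)) X| ≤ τ)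
    {k : ℕ} (hk : k ≤ N) {X : Space d} (hX : X ∈ vertices P m) : |e k X| ≤ k * (h * τ) := by
  induction k generalizing X with
  | zero =>
    rw [Nat.cast_zero, zero_mul, abs_nonpos_iff]
    by_cases hX₀ : X ∈ vertices P 0
    · exact he_boundary 0 hk X hX₀
    · exact he_initial X (mem_interiorVertices.2 ⟨hX, hX₀⟩)
  | succ k ih =>
    refine abs_le_of_abs_sub_normLaplacian_le hh.le (by positivity) (he_boundary (k + 1) hk)
      (fun Y hY => ?_) hX
    have step_eq : e (k + 1) Y - h * normLaplacian P m (e (k + 1)) Y = e k Y +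
        h * ((e (k + 1) Y - e k Y) / h - normLaplacian P m (e (k + 1)) Y) := by
      field_simp
      ring
    calc
      _ ≤ |e k Y| + h * |(e (k + 1) Y - e k Y) / h - normLaplacian P m (e (k + 1)) Y| := by
        rw [step_eq, ← abs_of_pos hh, ← abs_mul, abs_of_pos hh]
        exact abs_add_le _ _
      _ ≤ k * (h * τ) + h * τ := by
        gcongr
        exacts [ih (Nat.le_of_succ_le hk) (mem_interiorVertices.1 hY).1, he_step k hk Y hY]
      _ = (k + 1 : ℕ) * (h * τ) := by
        push_cast
        ring

end MaximumPrinciple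

section EulerMatrix

variable {m : ℕ} {h : ℝ} {f : Space d → ℝ}

open scoped Classical in
theorem laplacianMatrix_mulVec (hP : Function.Injective P) (hf₀ : ∀ X ∈ vertices P 0, f X = 0)
    (X : interiorVertices P m) :
    (laplacianMatrix P m).mulVec (interiorVector P m f) X = -normLaplacian P m f X := by
  have entry_mul (Y : interiorVertices P m) : laplacianMatrix P m X Y * f Y = normalization d m *
      ((if Y = X then (((vertices P m).filter fun Z => Neighbour P m X Z).card : ℝ) * f X
        else 0) - if Neighbour P m X Y then f Y else 0) := by
    rw [laplacianMatrix, Matrix.of_apply, mul_assoc, ite_mul]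
    rcases eq_or_ne X Y with rfl | hXY
    · simp [not_neighbour_self hP]
    · rw [if_neg hXY, if_neg hXY.symm, zero_sub]
      split_ifs <;> ring
  have neighbour_sum : ∑ Y : interiorVertices P m, (if Neighbour P m X Y then f Y else 0) =
      ∑ Y ∈ (vertices P m).filter fun Y => Neighbour P m X Y, f Y := by
    rw [Finset.sum_coe_sort (interiorVertices P m) fun Y => if Neighbour P m X Y then f Y else 0,
      Finset.sum_filter]
    refine Finset.sum_subset Finset.sdiff_subset fun Y hY hY' => ?_
    have hY₀ : Y ∈ vertices P 0 := by
      by_contra hY₀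
      exact hY' (mem_interiorVertices.2 ⟨hY, hY₀⟩)
    rw [hf₀ Y hY₀, ite_self]
  calc
    _ = ∑ Y : interiorVertices P m, laplacianMatrix P m X Y * f Y := rfl
    _ = _ := by
      simp only [entry_mul]
      rw [← Finset.mul_sum, Finset.sum_sub_distrib, neighbour_sum, Finset.sum_ite_eq',
        if_pos (Finset.mem_univ X), normLaplacian, graphLaplacian, Finset.sum_sub_distrib,
        Finset.sum_const, nsmul_eq_mul]
      ring

open scoped Classical in
theorem eulerMatrix_mulVec (hP : Function.Injective P) (h : ℝ)
    (hf₀ : ∀ X ∈ vertices P 0, f X = 0) (X : interiorVertices P m) :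
    (eulerMatrix P m h).mulVec (interiorVector P m f) X = f X - h * normLaplacian P m f X := by
  rw [eulerMatrix, Matrix.add_mulVec, Matrix.smul_mulVec, Matrix.one_mulVec, Pi.add_apply,
    Pi.smul_apply, laplacianMatrix_mulVec hP hf₀, smul_eq_mul, mul_neg, ← sub_eq_add_neg,
    interiorVector]

open scoped Classical in
/-- The extension by zero of a vector indexed by the interior vertices of level `m`. -/
def extendZero (v : interiorVertices P m → ℝ) (X : Space d) : ℝ :=
  if hX : X ∈ interiorVertices P m then v ⟨X, hX⟩ else 0

theorem extendZero_eq_zero (v : interiorVertices P m → ℝ) {X : Space d} (hX : X ∈ vertices P 0) :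
    extendZero v X = 0 :=
  dif_neg fun h => (mem_interiorVertices.1 h).2 hX

theorem extendZero_apply (v : interiorVertices P m → ℝ) (X : interiorVertices P m) :
    extendZero v X = v X :=
  dif_pos X.2

theorem interiorVector_extendZero (v : interiorVertices P m → ℝ) :
    interiorVector P m (extendZero v) = v :=
  funext (extendZero_apply v)

open scoped Classical in
theorem eulerMatrix_mulVec_eq_extendZero (hP : Function.Injective P) (h : ℝ)
    (v : interiorVertices P m → ℝ) (X : interiorVertices P m) :
    (eulerMatrix P m h).mulVec v X =
      extendZero v X - h * normLaplacian P m (extendZero v) X := by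
  rw [← eulerMatrix_mulVec hP h (fun Y hY => extendZero_eq_zero v hY) X, interiorVector_extendZero]

open scoped Classical in
theorem norm_le_norm_eulerMatrix_mulVec (hP : Function.Injective P) (hh : 0 ≤ h)
    (v : interiorVertices P m → ℝ) : ‖v‖ ≤ ‖(eulerMatrix P m h).mulVec v‖ := by
  refine (pi_norm_le_iff_of_nonneg (norm_nonneg _)).2 fun X => ?_
  rw [Real.norm_eq_abs, ← extendZero_apply v X]
  refine abs_le_of_abs_sub_normLaplacian_le hh (norm_nonneg _)
    (fun Y hY => extendZero_eq_zero v hY) (fun Y hY => ?_) (mem_interiorVertices.1 X.2).1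
  rw [← eulerMatrix_mulVec_eq_extendZero hP h v ⟨Y, hY⟩]
  exact norm_le_pi_norm ((eulerMatrix P m h).mulVec v) ⟨Y, hY⟩

open scoped Classical in
theorem isUnit_eulerMatrix (hP : Function.Injective P) (m : ℕ) (hh : 0 ≤ h) :
    IsUnit (eulerMatrix P m h) := by
  rw [← Matrix.mulVec_injective_iff_isUnit]
  intro v w hvw
  have hle := norm_le_norm_eulerMatrix_mulVec hP hh (v - w)
  rw [Matrix.mulVec_sub, sub_eq_zero.2 hvw, norm_zero] at hle
  exact sub_eq_zero.1 (norm_le_zero_iff.1 hle)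

open scoped Classical in
theorem eulerMatrix_mulVec_inv_mulVec (hP : Function.Injective P) (hh : 0 ≤ h)
    (v : interiorVertices P m → ℝ) :
    (eulerMatrix P m h).mulVec ((eulerMatrix P m h)⁻¹.mulVec v) = v := by
  rw [Matrix.mulVec_mulVec, Matrix.mul_nonsing_inv _
    ((Matrix.isUnit_iff_isUnit_det _).1 (isUnit_eulerMatrix hP m hh)), Matrix.one_mulVec]

theorem linfty_opNorm_le_of_norm_mulVec_le {𝕜 ι κ : Type*} [NontriviallyNormedField 𝕜]
    [NormedAlgebra ℝ 𝕜] [Fintype ι] [Fintype κ] {A : Matrix ι κ 𝕜} {C : ℝ} (hC : 0 ≤ C)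
    (hA : ∀ v, ‖A.mulVec v‖ ≤ C * ‖v‖) : ‖A‖ ≤ C := by
  classical
  rw [Matrix.linfty_opNorm_eq_opNorm]
  exact ContinuousLinearMap.opNorm_le_bound _ hC hA

open scoped Classical in
theorem norm_eulerMatrix_inv_pow_le (hP : Function.Injective P) (m : ℕ) (hh : 0 ≤ h) (n : ℕ) :
    ‖(eulerMatrix P m h)⁻¹ ^ n‖ ≤ 1 := by
  refine linfty_opNorm_le_of_norm_mulVec_le zero_le_one fun v => ?_
  rw [one_mul]
  induction n with
  | zero => rw [pow_zero, Matrix.one_mulVec]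
  | succ n ih =>
    rw [pow_succ', ← Matrix.mulVec_mulVec]
    refine (norm_le_norm_eulerMatrix_mulVec hP hh _).trans ?_
    rwa [eulerMatrix_mulVec_inv_mulVec hP hh]

end EulerMatrix

section ImplicitEuler

variable {m N : ℕ} {h : ℝ} {g : Space d → ℝ} {U : ℕ → Space d → ℝ}

open scoped Classical in
theorem IsImplicitEuler.eulerMatrix_mulVec_eq (hP : Function.Injective P) (hh : 0 < h)
    (hU : IsImplicitEuler P m h N g U) {k : ℕ} (hk : k < N) :
    (eulerMatrix P m h).mulVec (interiorVector P m (U (k + 1))) = interiorVector P m (U k) := by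
  funext X
  have hstep := hU.step k hk X X.2
  rw [div_eq_iff hh.ne'] at hstep
  rw [eulerMatrix_mulVec hP h (hU.boundary (k + 1) hk), normLaplacian, interiorVector]
  linarith

theorem IsImplicitEuler.norm_interiorVector_le (hP : Function.Injective P) (hh : 0 < h)
    (hU : IsImplicitEuler P m h N g U) {k : ℕ} (hk : k ≤ N) :
    ‖interiorVector P m (U k)‖ ≤ ‖interiorVector P m (U 0)‖ := by
  classical
  induction k with
  | zero => exact le_rfl
  | succ k ih =>
    refine (norm_le_norm_eulerMatrix_mulVec hP hh.le _).trans ?_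
    rw [hU.eulerMatrix_mulVec_eq hP hh hk]
    exact ih (Nat.le_of_succ_le hk)

theorem IsImplicitEuler.abs_sub_le {τ : ℝ} (hh : 0 < h) (hτ : 0 ≤ τ)
    (hU : IsImplicitEuler P m h N g U) {v : ℕ → Space d → ℝ}
    (hv_boundary : ∀ k ≤ N, ∀ X ∈ vertices P 0, v k X = 0)
    (hv_initial : ∀ X ∈ interiorVertices P m, v 0 X = g X)
    (hv_step : ∀ k < N, ∀ X ∈ interiorVertices P m,
      |(v (k + 1) X - v k X) / h - normLaplacian P m (v (k + 1)) X| ≤ τ)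
    {k : ℕ} (hk : k ≤ N) {X : Space d} (hX : X ∈ vertices P m) :
    |v k X - U k X| ≤ k * (h * τ) := by
  refine abs_le_of_abs_residual_le (e := fun k X => v k X - U k X) hh hτ
    (fun l hl Y hY => by rw [hv_boundary l hl Y hY, hU.boundary l hl Y hY, sub_zero])
    (fun Y hY => by rw [hv_initial Y hY, hU.initial Y hY, sub_self])
    (fun l hl Y hY => ?_) hk hX
  convert hv_step l hl Y hY using 2
  simp only [normLaplacian, graphLaplacian_sub, mul_sub, ← hU.step l hl Y hY]
  ring

theorem IsImplicitEuler.eq {U' : ℕ → Space d → ℝ} (hh : 0 < h)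
    (hU : IsImplicitEuler P m h N g U) (hU' : IsImplicitEuler P m h N g U') {k : ℕ} (hk : k ≤ N)
    {X : Space d} (hX : X ∈ vertices P m) : U k X = U' k X := by
  have hdiff : |U k X - U' k X| ≤ k * (h * 0) :=
    hU'.abs_sub_le hh le_rfl hU.boundary hU.initial
      (fun l hl Y hY => by rw [hU.step l hl Y hY, normLaplacian, sub_self, abs_zero]) hk hX
  rwa [mul_zero, mul_zero, abs_nonpos_iff, sub_eq_zero] at hdiff

theorem exists_isImplicitEuler (hP : Function.Injective P) (m N : ℕ) (g : Space d → ℝ)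
    (hh : 0 < h) : ∃ U, IsImplicitEuler P m h N g U := by
  classical
  let V : ℕ → interiorVertices P m → ℝ := fun k =>
    ((eulerMatrix P m h)⁻¹.mulVec)^[k] (interiorVector P m g)
  refine ⟨fun k => extendZero (V k), fun k _ X hX => ?_, fun k _ X hX => extendZero_eq_zero _ hX,
    fun X hX => extendZero_apply (V 0) ⟨X, hX⟩⟩
  have hstep : (eulerMatrix P m h).mulVec (V (k + 1)) = V k := by
    simp only [V, Function.iterate_succ_apply']
    exact eulerMatrix_mulVec_inv_mulVec hP hh.le _
  have hX_step := eulerMatrix_mulVec_eq_extendZero hP h (V (k + 1)) ⟨X, hX⟩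
  rw [hstep, ← extendZero_apply (V k) ⟨X, hX⟩, normLaplacian] at hX_step
  rw [div_eq_iff hh.ne']
  linarith

end ImplicitEuler

section NormTwoInfty

theorem normTwoInfty_nonneg (P : Fin d → Space d) (m N : ℕ) (w : ℕ → Space d → ℝ) :
    0 ≤ normTwoInfty P m N w :=
  (Real.sqrt_nonneg _).trans
    (Finset.le_sup' (fun k => √(((d : ℝ) ^ m)⁻¹ * ∑ X ∈ vertices P m, |w k X| ^ 2))
      (Finset.mem_range.2 N.succ_pos))

theorem normTwoInfty_le {m N : ℕ} {w : ℕ → Space d → ℝ} {E : ℝ} (hE : 0 ≤ E)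
    (hw : ∀ k ≤ N, ∀ X ∈ vertices P m, |w k X| ≤ E) : normTwoInfty P m N w ≤ √d * E := by
  refine Finset.sup'_le _ _ fun k hk => ?_
  rw [← Real.sqrt_sq hE, ← Real.sqrt_mul d.cast_nonneg]
  refine Real.sqrt_le_sqrt ?_
  have hk' : k ≤ N := Nat.lt_succ_iff.1 (Finset.mem_range.1 hk)
  calc
    _ ≤ ((d : ℝ) ^ m)⁻¹ * ((vertices P m).card * E ^ 2) := by
      gcongr
      rw [← nsmul_eq_mul]
      exact Finset.sum_le_card_nsmul _ _ _ fun X hX => by gcongr; exact hw k hk' X hX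
    _ ≤ ((d : ℝ) ^ m)⁻¹ * ((d : ℝ) ^ (m + 1) * E ^ 2) := by
      gcongr
      exact_mod_cast card_vertices_le P m
    _ = ((d : ℝ) ^ m)⁻¹ * (d : ℝ) ^ m * (d * E ^ 2) := by ring
    _ ≤ d * E ^ 2 := mul_le_of_le_one_left (by positivity) inv_mul_le_one

end NormTwoInfty

section TimeDerivatives

theorem abs_backward_difference_sub_le {φ φ' φ'' : ℝ → ℝ} {T M : ℝ}
    (hφ : ∀ t ∈ Icc 0 T, HasDerivWithinAt φ (φ' t) (Icc 0 T) t)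
    (hφ' : ∀ t ∈ Icc 0 T, HasDerivWithinAt φ' (φ'' t) (Icc 0 T) t)
    (hM : ∀ t ∈ Icc 0 T, |φ'' t| ≤ M) {a b : ℝ} (ha : 0 ≤ a) (hab : a < b) (hb : b ≤ T) :
    |(φ b - φ a) / (b - a) - φ' b| ≤ M * (b - a) := by
  have hsub : Icc a b ⊆ Icc 0 T := Icc_subset_Icc ha hb
  have hb_mem : b ∈ Icc a b := right_mem_Icc.2 hab.le
  have hM₀ : 0 ≤ M := (abs_nonneg _).trans (hM b (hsub hb_mem))
  have hderiv : ∀ t ∈ Icc a b, ‖φ' t - φ' b‖ ≤ M * (b - a) := fun t ht => by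
    refine ((convex_Icc 0 T).norm_image_sub_le_of_norm_hasDerivWithin_le hφ' hM
      (hsub hb_mem) (hsub ht)).trans ?_
    rw [norm_sub_rev, Real.norm_of_nonneg (sub_nonneg.2 ht.2)]
    gcongr
    exact ht.1
  have hsub_linear : ∀ t ∈ Icc a b,
      HasDerivWithinAt (fun s => φ s - s * φ' b) (φ' t - φ' b) (Icc a b) t := fun t ht => by
    simpa only [one_mul] using
      ((hφ t (hsub ht)).mono hsub).fun_sub ((hasDerivAt_id' t).hasDerivWithinAt.mul_const (φ' b))
  have hmean := (convex_Icc a b).norm_image_sub_le_of_norm_hasDerivWithin_le hsub_linear hderiv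
    (left_mem_Icc.2 hab.le) hb_mem
  have hpos : 0 < b - a := sub_pos.2 hab
  rw [Real.norm_eq_abs, Real.norm_of_nonneg hpos.le] at hmean
  have hdiff : φ b - b * φ' b - (φ a - a * φ' b) = φ b - φ a - (b - a) * φ' b := by ring
  rw [div_sub' hpos.ne', abs_div, abs_of_pos hpos, div_le_iff₀ hpos, ← hdiff]
  exact hmean

theorem abs_le_of_forall_Ioo {φ : ℝ → ℝ} {T B : ℝ} (hT : 0 < T) (hφ : ContinuousOn φ (Icc 0 T))
    (hB : ∀ t ∈ Ioo 0 T, |φ t| ≤ B) {t : ℝ} (ht : t ∈ Icc 0 T) : |φ t| ≤ B := by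
  rw [← closure_Ioo hT.ne] at hφ ht
  exact le_on_closure (f := fun t => |φ t|) hB hφ.abs continuousOn_const ht

theorem natCast_mul_div_mem_Icc {T : ℝ} (hT : 0 ≤ T) {k N : ℕ} (hk : k ≤ N) :
    (k : ℝ) * (T / N) ∈ Icc 0 T := by
  refine ⟨by positivity, ?_⟩
  rw [mul_div_left_comm]
  exact mul_le_of_le_one_right hT
    (div_le_one_of_le₀ (Nat.cast_le.2 hk) N.cast_nonneg)

/-- `u' t X` and `u'' t X` are the first two time derivatives of `u t X` for `t` in `[0, T]`, the
second one being bounded by `M`: the witnesses of `HasBoundedSecondTimeDeriv` given names. -/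
structure HasTimeDerivs (P : Fin d → Space d) (T : ℝ) (u u' u'' : ℝ → Space d → ℝ) (M : ℝ) :
    Prop where
  hasDerivWithinAt : ∀ X ∈ simplex P, ∀ t ∈ Icc 0 T,
    HasDerivWithinAt (fun s => u s X) (u' t X) (Icc 0 T) t
  hasDerivWithinAt_deriv : ∀ X ∈ simplex P, ∀ t ∈ Icc 0 T,
    HasDerivWithinAt (fun s => u' s X) (u'' t X) (Icc 0 T) t
  abs_le : ∀ X ∈ simplex P, ∀ t ∈ Icc 0 T, |u'' t X| ≤ M

variable {T M : ℝ} {u u' u'' : ℝ → Space d → ℝ}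

theorem HasBoundedSecondTimeDeriv.exists_hasTimeDerivs (hu : HasBoundedSecondTimeDeriv P T u) :
    ∃ u' u'' M, 0 ≤ M ∧ HasTimeDerivs P T u u' u'' M := by
  obtain ⟨u', u'', M, h⟩ := hu
  exact ⟨u', u'', |M|, abs_nonneg M, fun X hX t ht => (h X hX t ht).1,
    fun X hX t ht => (h X hX t ht).2.1, fun X hX t ht => (h X hX t ht).2.2.trans (le_abs_self M)⟩

theorem HasTimeDerivs.hasDerivAt (hD : HasTimeDerivs P T u u' u'' M) {X : Space d}
    (hX : X ∈ simplex P) {t : ℝ} (ht : t ∈ Ioo 0 T) : HasDerivAt (fun s => u s X) (u' t X) t :=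
  (hD.hasDerivWithinAt X hX t (Ioo_subset_Icc_self ht)).hasDerivAt (Icc_mem_nhds ht.1 ht.2)

theorem HasTimeDerivs.continuousOn (hD : HasTimeDerivs P T u u' u'' M) {X : Space d}
    (hX : X ∈ simplex P) : ContinuousOn (fun t => u t X) (Icc 0 T) :=
  fun t ht => (hD.hasDerivWithinAt X hX t ht).continuousWithinAt

theorem HasTimeDerivs.continuousOn_deriv (hD : HasTimeDerivs P T u u' u'' M) {X : Space d}
    (hX : X ∈ simplex P) : ContinuousOn (fun t => u' t X) (Icc 0 T) :=
  fun t ht => (hD.hasDerivWithinAt_deriv X hX t ht).continuousWithinAt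

theorem HasTimeDerivs.continuousOn_normLaplacian (hD : HasTimeDerivs P T u u' u'' M) {m : ℕ}
    {X : Space d} (hX : X ∈ simplex P) :
    ContinuousOn (fun t => normLaplacian P m (u t) X) (Icc 0 T) := by
  classical
  exact continuousOn_const.mul (continuousOn_finsetSum _ fun Y hY => (hD.continuousOn
    (vertices_subset_simplex P m (Finset.mem_filter.1 hY).1)).sub (hD.continuousOn hX))

end TimeDerivatives

section HeatSolution

variable {T M : ℝ} {g : Space d → ℝ} {u u' u'' : ℝ → Space d → ℝ}

theorem HasLaplacian.congr_right {f F G : Space d → ℝ} (hf : HasLaplacian P f F)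
    (h : ∀ X ∈ simplex P, F X = G X) : HasLaplacian P f G where
  continuousOn := hf.continuousOn
  continuousOn_laplacian := hf.continuousOn_laplacian.congr fun X hX => (h X hX).symm
  tendsto X hX := h X hX ▸ hf.tendsto X hX

theorem IsHeatSolution.hasLaplacian (hu : IsHeatSolution P T g u)
    (hD : HasTimeDerivs P T u u' u'' M) {t : ℝ} (ht : t ∈ Ioo 0 T) :
    HasLaplacian P (u t) (u' t) := by
  obtain ⟨F, hF, hFu⟩ := hu.heat t ht
  exact hF.congr_right fun X hX => (hFu X hX).unique (hD.hasDerivAt hX ht)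

theorem IsHeatSolution.eq_zero_of_mem_Icc (hT : 0 < T) (hu : IsHeatSolution P T g u)
    (hD : HasTimeDerivs P T u u' u'' M) {X : Space d} (hX : X ∈ vertices P 0) {t : ℝ}
    (ht : t ∈ Icc 0 T) : u t X = 0 :=
  abs_nonpos_iff.1 (abs_le_of_forall_Ioo (φ := fun t => u t X) hT
    (hD.continuousOn (vertices_subset_simplex P 0 hX))
    (fun s hs => by rw [hu.boundary s (Ioo_subset_Ico_self hs) X hX, abs_zero]) ht)

theorem IsHeatSolution.isResistanceLipschitz_sub (hP : AffineIndependent ℝ P)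
    (hu : IsHeatSolution P T g u) (hD : HasTimeDerivs P T u u' u'' M) {s t : ℝ} (hs : s ∈ Ioo 0 T)
    (ht : t ∈ Ioo 0 T) : IsResistanceLipschitz P (M * |s - t|) fun X => u s X - u t X :=
  ((hu.hasLaplacian hD hs).sub (hu.hasLaplacian hD ht)).isResistanceLipschitz hP
    (fun X hX => by
      rw [hu.boundary s (Ioo_subset_Ico_self hs) X hX,
        hu.boundary t (Ioo_subset_Ico_self ht) X hX, sub_zero])
    fun X hX => (convex_Icc 0 T).norm_image_sub_le_of_norm_hasDerivWithin_le
      (hD.hasDerivWithinAt_deriv X hX) (hD.abs_le X hX)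
      (Ioo_subset_Icc_self ht) (Ioo_subset_Icc_self hs)

theorem IsHeatSolution.isResistanceLipschitz_deriv (hP : AffineIndependent ℝ P)
    (hu : IsHeatSolution P T g u) (hD : HasTimeDerivs P T u u' u'' M) {t : ℝ} (ht : t ∈ Ioo 0 T) :
    IsResistanceLipschitz P M (u' t) := by
  intro w i j
  have hmem (l : Fin d) : wordMap P w (P l) ∈ simplex P :=
    wordMap_mem_simplex (apply_mem_simplex P l) w
  have hM₀ : 0 ≤ M :=
    (abs_nonneg _).trans (hD.abs_le _ (hmem i) t (Ioo_subset_Icc_self ht))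
  refine ((hD.hasDerivAt (hmem i) ht).sub (hD.hasDerivAt (hmem j) ht)).le_of_lip'
    (by positivity) ?_
  filter_upwards [Ioo_mem_nhds ht.1 ht.2] with s hs
  have hincrement := hu.isResistanceLipschitz_sub hP hD hs ht w i j
  rw [sub_sub_sub_comm, mul_right_comm] at hincrement
  exact hincrement

theorem IsHeatSolution.abs_normLaplacian_sub_le (hT : 0 < T) (hP : AffineIndependent ℝ P)
    (hu : IsHeatSolution P T g u) (hD : HasTimeDerivs P T u u' u'' M) {m : ℕ} {X : Space d}
    (hX : X ∈ interiorVertices P m) {t : ℝ} (ht : t ∈ Icc 0 T) :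
    |normLaplacian P m (u t) X - u' t X| ≤ (d + 2) * M * ((d : ℝ) / (d + 2)) ^ m := by
  have hXs := mem_simplex_of_mem_interiorVertices hX
  exact abs_le_of_forall_Ioo (φ := fun t => normLaplacian P m (u t) X - u' t X) hT
    ((hD.continuousOn_normLaplacian hXs).sub (hD.continuousOn_deriv hXs))
    (fun s hs => (hu.hasLaplacian hD hs).abs_normLaplacian_sub_le hP
      (hu.isResistanceLipschitz_deriv hP hD hs) hX) ht

theorem IsHeatSolution.abs_truncationError_le (hP : AffineIndependent ℝ P)
    (hu : IsHeatSolution P T g u) (hD : HasTimeDerivs P T u u' u'' M) (hM : 0 ≤ M) {m : ℕ}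
    {X : Space d} (hX : X ∈ interiorVertices P m) {a b : ℝ} (ha : 0 ≤ a) (hab : a < b)
    (hb : b ≤ T) :
    |(u b X - u a X) / (b - a) - normLaplacian P m (u b) X| ≤
      (d + 2) * M * (b - a + ((d : ℝ) / (d + 2)) ^ m) := by
  have hXs := mem_simplex_of_mem_interiorVertices hX
  have hb₀ : 0 < b := ha.trans_lt hab
  have htime := abs_backward_difference_sub_le (hD.hasDerivWithinAt X hXs)
    (hD.hasDerivWithinAt_deriv X hXs) (hD.abs_le X hXs) ha hab hb
  have hspace := hu.abs_normLaplacian_sub_le (hb₀.trans_le hb) hP hD hX ⟨hb₀.le, hb⟩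
  rw [abs_sub_comm] at hspace
  calc
    _ ≤ M * (b - a) + (d + 2) * M * ((d : ℝ) / (d + 2)) ^ m :=
      (abs_sub_le _ (u' b X) _).trans (add_le_add htime hspace)
    _ ≤ (d + 2) * M * (b - a) + (d + 2) * M * ((d : ℝ) / (d + 2)) ^ m := by
      gcongr
      exact le_mul_of_one_le_left hM (by linarith [d.cast_nonneg (α := ℝ)])
    _ = (d + 2) * M * (b - a + ((d : ℝ) / (d + 2)) ^ m) := by ring

theorem IsHeatSolution.abs_sub_implicitEuler_le (hT : 0 < T) (hP : AffineIndependent ℝ P)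
    (hu : IsHeatSolution P T g u) (hD : HasTimeDerivs P T u u' u'' M) (hM : 0 ≤ M) {m N : ℕ}
    (hN : 1 ≤ N) {U : ℕ → Space d → ℝ} (hU : IsImplicitEuler P m (T / N) N g U) {k : ℕ}
    (hk : k ≤ N) {X : Space d} (hX : X ∈ vertices P m) :
    |u (k * (T / N)) X - U k X| ≤ T * ((d + 2) * M * (T / N + ((d : ℝ) / (d + 2)) ^ m)) := by
  have hh : 0 < T / N := div_pos hT (Nat.cast_pos.2 hN)
  have htime {l : ℕ} (hl : l ≤ N) := natCast_mul_div_mem_Icc hT.le hl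
  have herror := hU.abs_sub_le (v := fun k => u (k * (T / N)))
    (τ := (d + 2) * M * (T / N + ((d : ℝ) / (d + 2)) ^ m)) hh (by positivity)
    (fun l hl Y hY => hu.eq_zero_of_mem_Icc hT hD hY (htime hl))
    (fun Y hY => by
      rw [Nat.cast_zero, zero_mul, hu.initial Y (mem_simplex_of_mem_interiorVertices hY)])
    (fun l hl Y hY => ?_) hk hX
  · rw [← mul_assoc] at herror
    exact herror.trans (mul_le_mul_of_nonneg_right (htime hk).2 (by positivity))
  · have hdiff : (l + 1 : ℕ) * (T / N) - l * (T / N) = T / N := by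
      push_cast
      ring
    have htruncation := hu.abs_truncationError_le hP hD hM hY (htime hl.le).1
      (sub_pos.1 (hh.trans_eq hdiff.symm)) (htime hl).2
    rwa [hdiff] at htruncation

theorem IsHeatSolution.eq_zero_of_isHolder (hT : 0 < T) (hP : AffineIndependent ℝ P)
    (hu : IsHeatSolution P T g u) (hD : HasTimeDerivs P T u u' u'' M) {α : ℝ}
    (hholder : ∀ t ∈ Ioo 0 T, IsHolder P α (u t)) (hα : (2⁻¹ : ℝ) ^ α < d / (d + 2)) {m : ℕ}
    {X : Space d} (hX : X ∈ vertices P m) {t : ℝ} (ht : t ∈ Icc 0 T) : u t X = 0 := by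
  by_cases hX₀ : X ∈ vertices P 0
  · exact hu.eq_zero_of_mem_Icc hT hD hX₀ ht
  have hd := two_le_of_mem_interiorVertices (mem_interiorVertices.2 ⟨hX, hX₀⟩)
  refine abs_nonpos_iff.1 (abs_le_of_forall_Ioo (φ := fun t => u t X) hT
    (hD.continuousOn (vertices_subset_simplex P m hX)) (fun s hs => ?_) ht)
  have hL := hu.hasLaplacian hD hs
  rw [hL.eq_zero_of_laplacian_eq_zero hP (hu.boundary s (Ioo_subset_Ico_self hs))
    (fun Y hY => hL.eq_zero_of_isHolder hd hP (hholder s hs) hα hY) hX, abs_zero]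

theorem IsHeatSolution.implicitEuler_eq_of_isHolder (hT : 0 < T) (hP : AffineIndependent ℝ P)
    (hu : IsHeatSolution P T g u) (hD : HasTimeDerivs P T u u' u'' M) {α : ℝ}
    (hholder : ∀ t ∈ Ioo 0 T, IsHolder P α (u t)) (hα : (2⁻¹ : ℝ) ^ α < d / (d + 2)) {m N : ℕ}
    (hN : 1 ≤ N) {U : ℕ → Space d → ℝ} (hU : IsImplicitEuler P m (T / N) N g U) {k : ℕ}
    (hk : k ≤ N) {X : Space d} (hX : X ∈ vertices P m) : u (k * (T / N)) X = U k X := by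
  have hzero : IsImplicitEuler P m (T / N) N g 0 :=
    ⟨by simp [graphLaplacian], by simp, fun Y hY => by
      rw [← hu.initial Y (mem_simplex_of_mem_interiorVertices hY), hu.eq_zero_of_isHolder hT hP hD
        hholder hα (mem_interiorVertices.1 hY).1 (left_mem_Icc.2 hT.le)]
      rfl⟩
  rw [hU.eq (div_pos hT (Nat.cast_pos.2 hN)) hzero hk hX,
    hu.eq_zero_of_isHolder hT hP hD hholder hα hX (natCast_mul_div_mem_Icc hT.le hk)]
  rfl

end HeatSolution

section Convergence

variable {T : ℝ} {g : Space d → ℝ} {u : ℝ → Space d → ℝ}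

theorem inv_two_rpow_pow (α : ℝ) (m : ℕ) : ((2⁻¹ : ℝ) ^ α) ^ m = (2 : ℝ) ^ (-(m * α)) := by
  rw [← Real.rpow_mul_natCast (by norm_num), Real.inv_rpow zero_le_two, ← Real.rpow_neg zero_le_two,
    mul_comm]

theorem IsHeatSolution.exists_normTwoInfty_le (hT : 0 < T) (hP : AffineIndependent ℝ P)
    (hu : IsHeatSolution P T g u) (hu₂ : HasBoundedSecondTimeDeriv P T u) :
    ∃ C : ℝ, ∀ (m N : ℕ) (U : ℕ → Space d → ℝ), 1 ≤ N → IsImplicitEuler P m (T / N) N g U →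
      normTwoInfty P m N (fun k X => u (k * (T / N)) X - U k X) ≤
          C * (T / N + ((d : ℝ) / (d + 2)) ^ m) ∧
        ∀ α : ℝ, (∀ t ∈ Ioo 0 T, IsHolder P α (u t)) →
          normTwoInfty P m N (fun k X => u (k * (T / N)) X - U k X) ≤
            C * (T / N + (2 : ℝ) ^ (-(m * α))) := by
  obtain ⟨u', u'', M, hM, hD⟩ := hu₂.exists_hasTimeDerivs
  refine ⟨√d * (T * ((d + 2) * M)), fun m N U hN hU => ?_⟩
  have hrate : normTwoInfty P m N (fun k X => u (k * (T / N)) X - U k X) ≤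
      √d * (T * ((d + 2) * M)) * (T / N + ((d : ℝ) / (d + 2)) ^ m) :=
    (normTwoInfty_le (by positivity) fun k hk X hX =>
      hu.abs_sub_implicitEuler_le hT hP hD hM hN hU hk hX).trans_eq (by ring)
  refine ⟨hrate, fun α hholder => ?_⟩
  rcases lt_or_ge ((2⁻¹ : ℝ) ^ α) (d / (d + 2)) with hα | hα
  · have hzero : normTwoInfty P m N (fun k X => u (k * (T / N)) X - U k X) ≤ √d * 0 :=
      normTwoInfty_le le_rfl fun k hk X hX => by
        rw [hu.implicitEuler_eq_of_isHolder hT hP hD hholder hα hN hU hk hX, sub_self, abs_zero]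
    exact hzero.trans (by rw [mul_zero]; positivity)
  · rw [← inv_two_rpow_pow]
    exact hrate.trans (by gcongr)

theorem tendsto_const_mul_div_add_pow (d : ℕ) (C T : ℝ) :
    Tendsto (fun p : ℕ × ℕ => C * (T / p.2 + ((d : ℝ) / (d + 2)) ^ p.1)) (atTop ×ˢ atTop)
      (𝓝 0) := by
  have hr : (d : ℝ) / (d + 2) < 1 := (div_lt_one (by positivity)).2 (by linarith)
  have htime := (tendsto_const_div_atTop_nhds_zero_nat T).comp
    (tendsto_snd (f := (atTop : Filter ℕ)) (g := atTop))
  have hspace := (tendsto_pow_atTop_nhds_zero_of_lt_one (by positivity) hr).comp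
    (tendsto_fst (f := (atTop : Filter ℕ)) (g := (atTop : Filter ℕ)))
  simpa only [Function.comp_apply, add_zero, mul_zero] using (htime.add hspace).const_mul C

theorem IsHeatSolution.tendsto_normTwoInfty (hT : 0 < T) (hP : AffineIndependent ℝ P)
    (hu : IsHeatSolution P T g u) (hu₂ : HasBoundedSecondTimeDeriv P T u)
    {U : ℕ → ℕ → ℕ → Space d → ℝ}
    (hU : ∀ m N : ℕ, 1 ≤ N → IsImplicitEuler P m (T / N) N g (U m N)) :
    Tendsto (fun p : ℕ × ℕ =>
      normTwoInfty P p.1 p.2 (fun k X => u (k * (T / p.2)) X - U p.1 p.2 k X))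
      (atTop ×ˢ atTop) (𝓝 0) := by
  obtain ⟨C, hC⟩ := hu.exists_normTwoInfty_le hT hP hu₂
  refine squeeze_zero' (.of_forall fun p => normTwoInfty_nonneg P _ _ _) ?_
    (tendsto_const_mul_div_add_pow d C T)
  filter_upwards [tendsto_snd.eventually (eventually_ge_atTop 1)] with p hp
  exact (hC p.1 p.2 (U p.1 p.2) hp (hU p.1 p.2 hp)).1

end Convergence

end SierpinskiHeat

end

open SierpinskiHeat in
open scoped Classical in
theorem mainTheorem3_general (d : ℕ) (P : Fin d → Space d) (hP : Function.Injective P) :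
    (∀ (m : ℕ) (h : ℝ), 0 < h →
      IsUnit (eulerMatrix P m h) ∧ ‖(eulerMatrix P m h)⁻¹‖ ≤ 1 ∧
        ∀ n : ℕ, ‖(eulerMatrix P m h)⁻¹ ^ n‖ ≤ 1) ∧
    (∀ (m : ℕ) (h : ℝ) (N : ℕ) (g : Space d → ℝ), 0 < h →
      ∃ U, IsImplicitEuler P m h N g U ∧
        ∀ U', IsImplicitEuler P m h N g U' → ∀ k ≤ N, ∀ X ∈ vertices P m, U' k X = U k X) ∧
    (∀ (m : ℕ) (h : ℝ) (N : ℕ) (g : Space d → ℝ) (U : ℕ → Space d → ℝ), 0 < h →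
      IsImplicitEuler P m h N g U →
        (∀ k < N, (eulerMatrix P m h).mulVec (interiorVector P m (U (k + 1))) =
          interiorVector P m (U k)) ∧
        ∀ k ≤ N, ‖interiorVector P m (U k)‖ ≤ ‖interiorVector P m (U 0)‖) ∧
    (AffineIndependent ℝ P → ∀ (T : ℝ) (g : Space d → ℝ) (u : ℝ → Space d → ℝ), 0 < T →
      IsHeatSolution P T g u → HasBoundedSecondTimeDeriv P T u →
        (∃ C : ℝ, ∀ (m N : ℕ) (U : ℕ → Space d → ℝ), 1 ≤ N →
          IsImplicitEuler P m (T / N) N g U →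
            normTwoInfty P m N (fun k X => u (k * (T / N)) X - U k X) ≤
                C * (T / N + ((d : ℝ) / (d + 2)) ^ m) ∧
              ∀ α : ℝ, (∀ t ∈ Set.Ioo 0 T, IsHolder P α (u t)) →
                normTwoInfty P m N (fun k X => u (k * (T / N)) X - U k X) ≤
                  C * (T / N + (2 : ℝ) ^ (-(m * α)))) ∧
        ∀ U : ℕ → ℕ → ℕ → Space d → ℝ,
          (∀ m N : ℕ, 1 ≤ N → IsImplicitEuler P m (T / N) N g (U m N)) →
            Filter.Tendsto
              (fun p : ℕ × ℕ =>
                normTwoInfty P p.1 p.2 (fun k X => u (k * (T / p.2)) X - U p.1 p.2 k X))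
              (Filter.atTop ×ˢ Filter.atTop) (nhds 0)) := by
  refine ⟨fun m h hh => ⟨isUnit_eulerMatrix hP m hh.le, ?_,
      norm_eulerMatrix_inv_pow_le hP m hh.le⟩, fun m h N g hh => ?_,
    fun m h N g U hh hU => ⟨fun k hk => hU.eulerMatrix_mulVec_eq hP hh hk,
      fun k hk => hU.norm_interiorVector_le hP hh hk⟩,
    fun hP T g u hT hu hu₂ => ⟨hu.exists_normTwoInfty_le hT hP hu₂,
      fun U hU => hu.tendsto_normTwoInfty hT hP hu₂ hU⟩⟩
  · simpa only [pow_one] using norm_eulerMatrix_inv_pow_le hP m hh.le 1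
  · obtain ⟨U, hU⟩ := exists_isImplicitEuler hP m N g hh
    exact ⟨U, hU, fun U' hU' k hk X hX => hU'.eq hh hU hk hX⟩

open SierpinskiHeat in
open scoped Classical in
theorem mainTheorem3 (d : ℕ) (hd : 1 ≤ d) (P : Fin d → Space d) (hP : AffineIndependent ℝ P) :
    -- the matrix of the scheme is invertible, and its inverse is bounded by 1 in the sup norm
    (∀ (m : ℕ) (h : ℝ), 0 < h →
      IsUnit (eulerMatrix P m h) ∧ ‖(eulerMatrix P m h)⁻¹‖ ≤ 1 ∧
        ∀ n : ℕ, ‖(eulerMatrix P m h)⁻¹ ^ n‖ ≤ 1) ∧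
    -- the scheme has exactly one solution
    (∀ (m : ℕ) (h : ℝ) (N : ℕ) (g : Space d → ℝ), 0 < h →
      ∃ U, IsImplicitEuler P m h N g U ∧
        ∀ U', IsImplicitEuler P m h N g U' → ∀ k ≤ N, ∀ X ∈ vertices P m, U' k X = U k X) ∧
    -- matrix form of the scheme, and unconditional stability in the sup norm
    (∀ (m : ℕ) (h : ℝ) (N : ℕ) (g : Space d → ℝ) (U : ℕ → Space d → ℝ), 0 < h →
      IsImplicitEuler P m h N g U →
        (∀ k < N, (eulerMatrix P m h).mulVec (interiorVector P m (U (k + 1))) =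
          interiorVector P m (U k)) ∧
        ∀ k ≤ N, ‖interiorVector P m (U k)‖ ≤ ‖interiorVector P m (U 0)‖) ∧
    -- error bound and convergence, without a restriction that links `T / N` and `m`
    (∀ (T α : ℝ) (g : Space d → ℝ) (u : ℝ → Space d → ℝ), 0 < T → 0 ≤ α →
      IsHeatSolution P T g u → HasBoundedSecondTimeDeriv P T u →
      (∀ t ∈ Set.Ioo 0 T, IsHolder P α (u t)) →
        (∃ C : ℝ, ∀ (m N : ℕ) (U : ℕ → Space d → ℝ), 1 ≤ N →
          IsImplicitEuler P m (T / N) N g U →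
            normTwoInfty P m N (fun k X => u (k * (T / N)) X - U k X) ≤
              C * (T / N + (2 : ℝ) ^ (-(m * α)))) ∧
        ∀ U : ℕ → ℕ → ℕ → Space d → ℝ,
          (∀ m N : ℕ, 1 ≤ N → IsImplicitEuler P m (T / N) N g (U m N)) →
            Filter.Tendsto
              (fun p : ℕ × ℕ =>
                normTwoInfty P p.1 p.2 (fun k X => u (k * (T / p.2)) X - U p.1 p.2 k X))
              (Filter.atTop ×ˢ Filter.atTop) (nhds 0)) := by
  obtain ⟨hmatrix, hexists, hscheme, hconv⟩ := mainTheorem3_general d P hP.injective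
  refine ⟨hmatrix, hexists, hscheme, fun T α g u hT _ hu hu₂ hholder => ?_⟩
  obtain ⟨⟨C, hC⟩, htendsto⟩ := hconv hP T g u hT hu hu₂
  exact ⟨⟨C, fun m N U hN hU => (hC m N U hN hU).2 α hholder⟩, htendsto⟩
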